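/- **Theorem 3.** Let $\xi_1,\xi_2,\dots$ be i.i.d. random variables, uniformly distributed on $(0,1)$, with order statistics $\xi_{n1}\le\dots\le\xi_{nn}$ of the first $n$ of them. *Kernel and bandwidth.* Let $k$ be a bounded probability density on $\mathbb R$ with zero mean and finite variance whose distribution function $K(x)=\int_{-\infty}^x k$ is differentiable, and let $b=b_n>0$ satisfy $b_n\to0$ and $nb_n\to\infty$. Put $$F_{n,b}(t)=\frac1{nb_n}\sum_{i=1}^n\int_{-\infty}^t k\Big(\frac{y-\xi_i}{b_n}\Big)\,dy,\qquad F_{n,b}^{-1}(u)=\inf\{t: F_{n,b}(t)\ge u\}.$$ *Scores.* Let $c_{n1},\dots,c_{nn}$ ($n\ge1$) be real constants and let $J_n(t)=c_{ni}$ for $(i-1)/n<t\le i/n$, $1\le i\le n$, and $J_n(0)=c_{n1}$. Let $J$ be a measurable function on $(0,1)$. Let $g$ be a left continuous function on $(0,1)$ that is of bounded variation on $(\theta,1-\theta)$ for every $\theta\in(0,1/2)$, and let $d|g|$ be its total variation measure on $(0,1)$. *Boundedness.* For some constants $b_1,b_2,M,\delta>0$ let, for $0<t<1$, $$B(t)=Mt^{-b_1}(1-t)^{-b_2},\quad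 D(t)=Mt^{-1+b_1+\delta}(1-t)^{-1+b_2+\delta},\quad h(t)=[t(1-t)]^{1-\delta/2},$$ and suppose that $|g|\le D$, $|J_n|\le B$ for all $n\ge1$, and $|J|\le B$ on $(0,1)$, and that $\int_0^1 B\,h\,d|g|<\infty$. Define $$T_n=\int_0^1 g\big(F_{n,b}^{-1}(u)\big)J_n(u)\,du,\qquad T_n'=\frac1n\sum_{i=1}^n g(\xi_{ni})\,c_{ni},\qquad \mu_n=\int_0^1 g(t)J_n(t)\,dt,$$ where $g(x)$ is read as $0$ for $x\notin(0,1)$. Then the integral $\mu_n$ exists for all $n\ge1$, almost surely the integral $T_n$ exists for all $n\ge1$, and $$\lim_{n\to\infty}(T_n-\mu_n)=0\quad\text{and}\quad \lim_{n\to\infty}(T_n'-\mu_n)=0\qquad\text{almost surely.}$$ -/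

import Mathlib

open MeasureTheory ProbabilityTheory Filter Set
open scoped Topology ENNReal

noncomputable section

namespace LStat

/-! ### The kernel and the bandwidth -/

/-- The distribution function `K(x) = ∫_{-∞}^x k` of a kernel density `k`. -/
def kernelDF (k : ℝ → ℝ) (x : ℝ) : ℝ := ∫ t in Iic x, k t

/-- `k` is a bounded probability density with differentiable distribution function, zero mean and
finite variance. -/
structure IsKernel (k : ℝ → ℝ) : Prop where
  nonneg : ∀ x, 0 ≤ k x
  integrable : Integrable k
  integral_eq_one : ∫ x, k x = 1
  bounded : ∃ C, ∀ x, k x ≤ C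
  differentiable : Differentiable ℝ (kernelDF k)
  integrable_mean : Integrable fun x => x * k x
  mean_eq_zero : ∫ x, x * k x = 0
  integrable_variance : Integrable fun x => x ^ 2 * k x

/-- The smoothing parameters `b_n > 0` satisfy `b_n → 0` and `n b_n → ∞`. -/
structure IsBandwidth (b : ℕ → ℝ) : Prop where
  pos : ∀ n, 1 ≤ n → 0 < b n
  tendsto_zero : Tendsto b atTop (𝓝 0)
  tendsto_atTop : Tendsto (fun n : ℕ => (n : ℝ) * b n) atTop atTop

/-- The kernel estimator `F_{n,b}(t) = (1/(nb)) ∑_{i=1}^n ∫_{-∞}^t k((y - x_i)/b) dy` of the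
distribution function, computed from the first `n` terms `x 0, …, x (n-1)` of `x`. -/
def kernelEst (k : ℝ → ℝ) (b : ℝ) (n : ℕ) (x : ℕ → ℝ) (t : ℝ) : ℝ :=
  1 / ((n : ℝ) * b) * ∑ i ∈ Finset.range n, ∫ y in Iic t, k ((y - x i) / b)

/-- The left continuous inverse `H⁻¹(u) = inf {t : u ≤ H(t)}` of a distribution function. -/
def leftInv (H : ℝ → ℝ) (u : ℝ) : ℝ := sInf {t | u ≤ H t}

/-! ### Scores and the L-statistic -/

/-- The score function: `J_n(t) = c_{ni}` for `(i-1)/n < t ≤ i/n`, `1 ≤ i ≤ n`, and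
`J_n(0) = c_{n1}`. -/
def score (c : ℕ → ℕ → ℝ) (n : ℕ) (t : ℝ) : ℝ := c n (max 1 ⌈(n : ℝ) * t⌉₊)

/-- The integrand `g(F_{n,b}⁻¹(u)) J_n(u)` of `T_n`. The function `g` lives on `(0,1)` only, whereas
`F_{n,b}⁻¹(u)` can lie outside `(0,1)`; there `g` is read as `0`. -/
def integrandT (g k : ℝ → ℝ) (c : ℕ → ℕ → ℝ) (b : ℝ) (n : ℕ) (x : ℕ → ℝ) (u : ℝ) : ℝ :=
  (Ioo (0 : ℝ) 1).indicator g (leftInv (kernelEst k b n x) u) * score c n u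

/-- `T_n = ∫₀¹ g(F_{n,b}⁻¹(u)) J_n(u) du`. -/
def statT (g k : ℝ → ℝ) (c : ℕ → ℕ → ℝ) (b : ℝ) (n : ℕ) (x : ℕ → ℝ) : ℝ :=
  ∫ u in Ioo (0 : ℝ) 1, integrandT g k c b n x u

/-- The order statistics of `x 0, …, x (n-1)`, in increasing order. -/
def orderStat (n : ℕ) (x : ℕ → ℝ) (i : Fin n) : ℝ :=
  x (Tuple.sort (fun j : Fin n => x j) i)

/-- The linear function of order statistics `(1/n) ∑_{i=1}^n g(x_{ni}) c_{ni}`. -/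
def statOrder (g : ℝ → ℝ) (c : ℕ → ℕ → ℝ) (n : ℕ) (x : ℕ → ℝ) : ℝ :=
  1 / (n : ℝ) * ∑ i : Fin n, g (orderStat n x i) * c n ((i : ℕ) + 1)

/-- `μ_n = ∫₀¹ g(t) J_n(t) dt`. -/
def centerMu (g : ℝ → ℝ) (c : ℕ → ℕ → ℝ) (n : ℕ) : ℝ :=
  ∫ t in Ioo (0 : ℝ) 1, g t * score c n t

/-! ### The class of functions `g` and the measure `d|g|` -/

/-- Left continuous functions on `(0,1)` that are of bounded variation on `(θ, 1-θ)` for all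
`θ ∈ (0,1/2)`. Values outside `(0,1)` play no role. -/
structure IsClassG (g : ℝ → ℝ) : Prop where
  leftCont : ∀ t ∈ Ioo (0 : ℝ) 1, ContinuousWithinAt g (Iic t) t
  bv : ∀ θ ∈ Ioo (0 : ℝ) (1 / 2), BoundedVariationOn g (Ioo θ (1 - θ))

theorem IsClassG.locallyBV {g : ℝ → ℝ} (hg : IsClassG g) :
    LocallyBoundedVariationOn g (Ioo 0 1) := by
  intro a b ha hb
  have h0 : (0 : ℝ) < min (min a (1 - b)) (1 / 2) / 2 := by
    have := ha.1
    have := hb.2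
    have h : (0 : ℝ) < min (min a (1 - b)) (1 / 2) :=
      lt_min (lt_min (by assumption) (by linarith)) (by norm_num)
    linarith
  have h1 : min (min a (1 - b)) (1 / 2) ≤ a := (min_le_left _ _).trans (min_le_left _ _)
  have h2 : min (min a (1 - b)) (1 / 2) ≤ 1 - b := (min_le_left _ _).trans (min_le_right _ _)
  have h3 : min (min a (1 - b)) (1 / 2) ≤ (1 / 2 : ℝ) := min_le_right _ _
  refine (hg.bv (min (min a (1 - b)) (1 / 2) / 2) ⟨h0, by linarith⟩).mono ?_
  rintro t ⟨-, hat, htb⟩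
  constructor <;> linarith

/-- The signed variation of `g` from `1/2` to `t ∈ (0,1)`. -/
def varFun (g : ℝ → ℝ) (t : Ioo (0 : ℝ) 1) : ℝ := variationOnFromTo g (Ioo 0 1) (1 / 2) t

theorem IsClassG.monotone_varFun {g : ℝ → ℝ} (hg : IsClassG g) : Monotone (varFun g) :=
  fun s t hst => variationOnFromTo.monotoneOn hg.locallyBV (by norm_num) s.2 t.2 hst

instance : CompactIccSpace (Ioo (0 : ℝ) 1) where
  isCompact_Icc {a b} := by
    rw [Subtype.isCompact_iff]
    have : (Subtype.val '' Icc a b : Set ℝ) = Icc (a : ℝ) b := by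
      ext t
      constructor
      · rintro ⟨s, hs, rfl⟩
        exact hs
      · intro ht
        exact ⟨⟨t, a.2.1.trans_le ht.1, ht.2.trans_lt b.2.2⟩, ht, rfl⟩
    rw [this]
    exact isCompact_Icc

/-- The total variation measure `d|g|` on `(0,1)`: the Stieltjes measure of the variation of `g`. -/
def IsClassG.varMeasure {g : ℝ → ℝ} (hg : IsClassG g) : Measure (Ioo (0 : ℝ) 1) :=
  hg.monotone_varFun.stieltjesFunction.measure

/-! ### The boundedness assumption -/

/-- `B(t) = M t^{-b₁} (1-t)^{-b₂}`. -/
def boundB (M b₁ b₂ t : ℝ) : ℝ := M * t ^ (-b₁) * (1 - t) ^ (-b₂)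

/-- `D(t) = M t^{-1+b₁+δ} (1-t)^{-1+b₂+δ}`. -/
def boundD (M b₁ b₂ δ t : ℝ) : ℝ := M * t ^ (-1 + b₁ + δ) * (1 - t) ^ (-1 + b₂ + δ)

/-- `h(t) = [t(1-t)]^{1-δ/2}`. -/
def weightH (δ t : ℝ) : ℝ := (t * (1 - t)) ^ (1 - δ / 2)

/-- On `(0,1)`: `|g| ≤ D`, `|J_n| ≤ B` for all `n ≥ 1`, `|J| ≤ B`, and `∫ B h d|g| < ∞`. -/
structure IsBounded (M b₁ b₂ δ : ℝ) (g : ℝ → ℝ) (hg : IsClassG g) (c : ℕ → ℕ → ℝ)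
    (J : Ioo (0 : ℝ) 1 → ℝ) : Prop where
  g_le : ∀ t ∈ Ioo (0 : ℝ) 1, |g t| ≤ boundD M b₁ b₂ δ t
  score_le : ∀ n, 1 ≤ n → ∀ t ∈ Ioo (0 : ℝ) 1, |score c n t| ≤ boundB M b₁ b₂ t
  J_le : ∀ t, |J t| ≤ boundB M b₁ b₂ t
  lintegral_lt_top :
    ∫⁻ t : Ioo (0 : ℝ) 1, ENNReal.ofReal (boundB M b₁ b₂ t * weightH δ t) ∂hg.varMeasure < ∞

end LStat

end

noncomputable section

namespace LStat

/-! ### Analytic preliminaries -/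

/-! Both statistics have the form ∫ g(G_n) J_n over (0,1), where G_n is the quantile function of the
kernel estimator for T_n and the empirical quantile function for T_n'. The claim is that ∫ (g(G_n) -
g) J_n tends to 0 along almost every sample path.

Pointwise convergence is soft. The law of large numbers at rational points gives G_n(u) → u, a
function of locally bounded variation is continuous almost everywhere, and |J_n| ≤ B uniformly in n.
The substance is uniform integrability near 0 and 1, obtained from a bound in L^p for some p > 1.

In g(G_n(u)) J_n(u) the two factors are evaluated at different points. An exponential inequality on
a grid of mesh 1/n, with Borel–Cantelli, shows t^(1+η) ≤ C (N_n(t) + 1)/n for all t and all large n,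
N_n(t) being the number of observations below t (`ae_eventually_rpow_le_countLT`); the reflected
sample 1 - ξ_i gives the other end. Hence the bound on J_n at u can be rewritten at G_n(u), with a
loss of b_i η in the exponents. As the powers b_i cancel in the product D B, the integrand is at
most a constant times [t(1-t)]^(-s) at t = G_n(u), for some s < 1
(`IsBounded.abs_indicator_mul_score_le`).

It remains to bound ∫ [G_n(1-G_n)]^(-sp) with sp < 1. For the empirical quantile function this is a
sample mean, and the strong law applies. For the kernel quantile function it is the mean of a
smoothed weight that changes with n, and a Chernoff bound replaces the strong law
(`ae_eventually_average_smoothing_le`). `IsBounded.tendsto_integral_sub_centerMu` combines these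
ingredients for any such G_n. -/

theorem integrableOn_rpow_mul_one_sub_rpow {p q : ℝ} (hp : -1 < p) (hq : -1 < q) :
    IntegrableOn (fun t : ℝ => t ^ p * (1 - t) ^ q) (Ioo 0 1) := by
  have hp' : 0 < p + 1 := by linarith
  have hq' : 0 < q + 1 := by linarith
  -- Up to the beta constant, the integrand is a probability density.
  have hint : Integrable (betaPDFReal (p + 1) (q + 1)) := by
    refine ⟨(measurable_betaPDFReal _ _).aestronglyMeasurable, ?_⟩
    rw [hasFiniteIntegral_iff_ofReal]
    · have := lintegral_betaPDF_eq_one hp' hq'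
      simp only [betaPDF] at this
      rw [this]
      exact ENNReal.one_lt_top
    · refine Eventually.of_forall fun t => ?_
      by_cases h : 0 < t ∧ t < 1
      · exact (betaPDFReal_pos h.1 h.2 hp' hq').le
      · simp [betaPDFReal, h]
  refine ((hint.const_mul (beta (p + 1) (q + 1))).integrableOn (s := Ioo 0 1)).congr_fun ?_
    measurableSet_Ioo
  intro t ht
  have := (beta_pos hp' hq').ne'
  simp only [betaPDFReal, if_pos (show 0 < t ∧ t < 1 from ht), add_sub_cancel_right]
  field_simp

/-- A sequence that is bounded in `L^p`, `p > 1`, and tends to `0` a.e. tends to `0` in `L^1`. -/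
theorem tendsto_lintegral_enorm_of_rpow_bounded {α : Type*} [MeasurableSpace α] {μ : Measure α}
    [IsFiniteMeasure μ] {f : ℕ → α → ℝ} (hf : ∀ n, AEMeasurable (f n) μ)
    (hlim : ∀ᵐ a ∂μ, Tendsto (fun n => f n a) atTop (𝓝 0)) {p : ℝ} (hp : 1 < p) {A : ℝ≥0∞}
    (hA : A ≠ ∞) (hbd : ∀ᶠ n in atTop, ∫⁻ a, ‖f n a‖ₑ ^ p ∂μ ≤ A) :
    Tendsto (fun n => ∫⁻ a, ‖f n a‖ₑ ∂μ) atTop (𝓝 0) := by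
  have hmin : ∀ R : ℝ≥0∞, R ≠ ∞ →
      Tendsto (fun n => ∫⁻ a, min ‖f n a‖ₑ R ∂μ) atTop (𝓝 0) := by
    intro R hR
    have := tendsto_lintegral_of_dominated_convergence' (μ := μ) (fun _ => R)
      (F := fun n a => min ‖f n a‖ₑ R) (f := fun _ => 0)
      (fun n => (hf n).enorm.min aemeasurable_const)
      (fun n => Eventually.of_forall fun a => min_le_right _ _)
      (by simpa using ENNReal.mul_ne_top hR (measure_ne_top μ _)) ?_
    · simpa using this
    · filter_upwards [hlim] with a ha
      have h1 : Tendsto (fun n => ‖f n a‖ₑ) atTop (𝓝 0) := by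
        simpa using ha.enorm
      simpa using h1.min (tendsto_const_nhds (x := R))
  -- Truncation at R: the truncated part is handled by dominated convergence, and the remainder has
  -- integral at most R^(1-p) A, uniformly in n and small for large R.
  have hpt : ∀ R : ℝ≥0∞, R ≠ 0 → R ≠ ∞ → ∀ x : ℝ, ‖x‖ₑ ≤ min ‖x‖ₑ R + R ^ (1 - p) * ‖x‖ₑ ^ p := by
    intro R hR0 hR x
    rcases le_total ‖x‖ₑ R with h | h
    · rw [min_eq_left h]
      exact le_self_add
    · refine le_add_left ?_
      have hx0 : ‖x‖ₑ ≠ 0 := fun h0 => hR0 (le_antisymm (h0 ▸ h) bot_le)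
      calc ‖x‖ₑ = ‖x‖ₑ ^ (1 - p) * ‖x‖ₑ ^ p := by
            rw [← ENNReal.rpow_add _ _ hx0 enorm_ne_top]
            simp
        _ ≤ R ^ (1 - p) * ‖x‖ₑ ^ p := by
            gcongr ?_ * _
            rw [← neg_sub p 1, ENNReal.rpow_neg, ENNReal.rpow_neg, ENNReal.inv_le_inv]
            exact ENNReal.rpow_le_rpow h (by linarith)
  rw [ENNReal.tendsto_nhds_zero]
  intro ε hε
  have hR : ∃ R : ℝ≥0∞, R ≠ 0 ∧ R ≠ ∞ ∧ R ^ (1 - p) * A ≤ ε / 2 := by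
    have h1 : Tendsto (fun r : ℝ => ENNReal.ofReal (r ^ (1 - p)) * A) atTop (𝓝 0) := by
      have h2 : Tendsto (fun r : ℝ => r ^ (1 - p)) atTop (𝓝 0) := by
        simpa using tendsto_rpow_neg_atTop (show 0 < p - 1 by linarith)
      have := ENNReal.Tendsto.mul_const (ENNReal.tendsto_ofReal h2) (Or.inr hA)
      simpa using this
    obtain ⟨r, hr, hr0⟩ := (((ENNReal.tendsto_nhds_zero.1 h1) (ε / 2)
      (ENNReal.half_pos hε.ne')).and (eventually_gt_atTop 0)).exists
    refine ⟨ENNReal.ofReal r, by simpa using hr0, ENNReal.ofReal_ne_top, ?_⟩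
    rwa [ENNReal.ofReal_rpow_of_pos hr0]
  obtain ⟨R, hR0, hRt, hRε⟩ := hR
  filter_upwards [hbd, (ENNReal.tendsto_nhds_zero.1 (hmin R hRt)) (ε / 2) (ENNReal.half_pos hε.ne')]
    with n h1 h2
  calc ∫⁻ a, ‖f n a‖ₑ ∂μ
      ≤ ∫⁻ a, (min ‖f n a‖ₑ R + R ^ (1 - p) * ‖f n a‖ₑ ^ p) ∂μ :=
        lintegral_mono fun a => hpt R hR0 hRt _
    _ = ∫⁻ a, min ‖f n a‖ₑ R ∂μ + R ^ (1 - p) * ∫⁻ a, ‖f n a‖ₑ ^ p ∂μ := by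
        rw [lintegral_add_left' ((hf n).enorm.min aemeasurable_const),
          lintegral_const_mul' _ _ (ENNReal.rpow_ne_top_of_ne_zero hR0 hRt)]
    _ ≤ ε / 2 + R ^ (1 - p) * A := by gcongr
    _ ≤ ε / 2 + ε / 2 := by gcongr
    _ = ε := ENNReal.add_halves ε

/-! ### The quantile transform -/

section Quantile

variable {H : ℝ → ℝ} {u : ℝ}

theorem le_leftInv {t s : ℝ} (hH : Monotone H) (ht : H t < u) (hs : u ≤ H s) : t ≤ leftInv H u :=
  le_csInf ⟨s, hs⟩ fun _ hr => le_of_not_gt fun h => absurd (hH h.le) (not_le.2 (ht.trans_le hr))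

theorem bddBelow_of_lt {t : ℝ} (hH : Monotone H) (ht : H t < u) : BddBelow {t | u ≤ H t} :=
  ⟨t, fun _ hr => le_of_not_gt fun h => absurd (hH h.le) (not_le.2 (ht.trans_le hr))⟩

theorem leftInv_le {t s : ℝ} (hH : Monotone H) (ht : H t < u) (hs : u ≤ H s) : leftInv H u ≤ s :=
  csInf_le (bddBelow_of_lt hH ht) hs

/-- Continuity makes the infimum attained and excludes jumps, so the quantile function is a genuine
right inverse. -/
theorem apply_leftInv (hH : Monotone H) (hc : Continuous H) (h0 : Tendsto H atBot (𝓝 0))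
    (h1 : Tendsto H atTop (𝓝 1)) (hu : u ∈ Ioo (0 : ℝ) 1) : H (leftInv H u) = u := by
  obtain ⟨t, ht⟩ := (h0.eventually_lt_const hu.1).exists
  obtain ⟨s, hs⟩ := (h1.eventually_const_lt hu.2).exists
  apply le_antisymm
  · by_contra! hlt
    obtain ⟨r, hr, hr'⟩ : ∃ r < leftInv H u, u < H r := by
      have : ∀ᶠ r in 𝓝[<] (leftInv H u), u < H r :=
        (hc.continuousAt.eventually (lt_mem_nhds hlt)).filter_mono nhdsWithin_le_nhds
      obtain ⟨r, hr, hr'⟩ := (this.and self_mem_nhdsWithin).exists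
      exact ⟨r, hr', hr⟩
    exact absurd (leftInv_le hH ht hr'.le) (not_le.2 hr)
  · have hcl : IsClosed {t | u ≤ H t} := isClosed_le continuous_const hc
    exact hcl.csInf_mem ⟨s, hs.le⟩ (bddBelow_of_lt hH ht)

theorem leftInv_le_iff (hH : Monotone H) (hc : Continuous H) (h0 : Tendsto H atBot (𝓝 0))
    (h1 : Tendsto H atTop (𝓝 1)) (hu : u ∈ Ioo (0 : ℝ) 1) (t : ℝ) :
    leftInv H u ≤ t ↔ u ≤ H t := by
  obtain ⟨s, hs⟩ := (h0.eventually_lt_const hu.1).exists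
  exact ⟨fun h => (apply_leftInv hH hc h0 h1 hu).symm.trans_le (hH h), fun h => leftInv_le hH hs h⟩

theorem aemeasurable_leftInv (hH : Monotone H) (hc : Continuous H) (h0 : Tendsto H atBot (𝓝 0))
    (h1 : Tendsto H atTop (𝓝 1)) : AEMeasurable (leftInv H) (volume.restrict (Ioo 0 1)) := by
  -- Monotonicity is only available on (0,1): elsewhere the set defining the infimum may be empty or
  -- unbounded below, and `sInf` returns a default value.
  refine aemeasurable_restrict_of_monotoneOn measurableSet_Ioo fun u hu v hv huv => ?_
  rw [leftInv_le_iff hH hc h0 h1 hu, apply_leftInv hH hc h0 h1 hv]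
  exact huv

/-- The equivalence of H⁻¹(u) ≤ t and u ≤ H(t) shows that the image of Lebesgue measure has
distribution function H. -/
theorem map_leftInv {ν : Measure ℝ} (hν : ∀ t, ν (Iic t) = ENNReal.ofReal (H t)) (hH : Monotone H)
    (hc : Continuous H) (h0 : Tendsto H atBot (𝓝 0)) (h1 : Tendsto H atTop (𝓝 1)) :
    (volume.restrict (Ioo 0 1)).map (leftInv H) = ν := by
  have hm := aemeasurable_leftInv hH hc h0 h1
  have : IsFiniteMeasure ((volume.restrict (Ioo (0 : ℝ) 1)).map (leftInv H)) := inferInstance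
  refine Measure.ext_of_Iic _ _ fun t => ?_
  rw [Measure.map_apply_of_aemeasurable hm measurableSet_Iic, hν,
    Measure.restrict_apply₀' measurableSet_Ioo.nullMeasurableSet]
  have hset : leftInv H ⁻¹' Iic t ∩ Ioo 0 1 = Iic (H t) ∩ Ioo 0 1 := by
    ext u
    simp only [mem_inter_iff, mem_preimage, mem_Iic]
    exact and_congr_left fun hu => leftInv_le_iff hH hc h0 h1 hu t
  have hle : H t ≤ 1 := hH.ge_of_tendsto h1 t
  rw [hset]
  apply le_antisymm
  · calc volume (Iic (H t) ∩ Ioo 0 1) ≤ volume (Ioc 0 (H t)) :=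
          measure_mono fun u hu => ⟨hu.2.1, hu.1⟩
      _ = _ := by simp
  · calc ENNReal.ofReal (H t) = volume (Ioo 0 (H t)) := by simp
      _ ≤ volume (Iic (H t) ∩ Ioo 0 1) := measure_mono fun u hu => ⟨hu.2.le, hu.1, hu.2.trans_le hle⟩

end Quantile

/-! ### Exponential inequalities and almost sure bounds -/

theorem summable_mul_exp_neg_rpow {c r : ℝ} (hc : 0 < c) (hr : 0 < r) :
    Summable fun n : ℕ => ((n : ℝ) + 1) * Real.exp (-(c * (n : ℝ) ^ r)) := by
  have h1 : Tendsto (fun n : ℕ => (n : ℝ) ^ r) atTop atTop :=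
    (tendsto_rpow_atTop hr).comp tendsto_natCast_atTop_atTop
  -- The exponent -3/r turns n^r into n^(-3), which leaves the summable n^(-2) after the factor n +
  -- 1.
  have h2 := ((isLittleO_exp_neg_mul_rpow_atTop hc (-(3 / r))).comp_tendsto h1).isBigO
  have h3 : (fun n : ℕ => (n : ℝ) + 1) =O[atTop] fun n : ℕ => (n : ℝ) := by
    refine Asymptotics.IsBigO.of_bound 2 ?_
    filter_upwards [eventually_ge_atTop 1] with n hn
    have : (1 : ℝ) ≤ n := by exact_mod_cast hn
    rw [Real.norm_of_nonneg (by positivity), Real.norm_of_nonneg (by positivity)]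
    linarith
  refine summable_of_isBigO_nat (g := fun n : ℕ => (n : ℝ) ^ (-2 : ℝ))
    (Real.summable_nat_rpow.2 (by norm_num)) ?_
  refine ((h3.mul h2).congr_left fun n => ?_).trans_eventuallyEq ?_
  · simp [neg_mul]
  · filter_upwards [eventually_ge_atTop 1] with n hn
    have hn' : (0 : ℝ) < n := by exact_mod_cast hn
    simp only [Function.comp]
    rw [← Real.rpow_mul hn'.le, ← Real.rpow_one_add' hn'.le]
    · congr 1
      field_simp
      norm_num
    · field_simp
      norm_num

section Probability

variable {Ω : Type*} [MeasurableSpace Ω] {P : Measure Ω} {ξ : ℕ → Ω → ℝ}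

theorem ae_tendsto_average (hmeas : ∀ i, Measurable (ξ i)) (hind : iIndepFun ξ P)
    (hmap : ∀ i, P.map (ξ i) = volume.restrict (Ioo 0 1)) {f : ℝ → ℝ} (hf : Measurable f)
    (hint : IntegrableOn f (Ioo 0 1)) :
    ∀ᵐ ω ∂P, Tendsto (fun n : ℕ => (∑ i ∈ Finset.range n, f (ξ i ω)) / n) atTop
      (𝓝 (∫ t in Ioo 0 1, f t)) := by
  have hi : Integrable (fun ω => f (ξ 0 ω)) P := by
    have : Integrable f (P.map (ξ 0)) := by rw [hmap]; exact hint
    exact this.comp_measurable (hmeas 0)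
  have h := strong_law_ae_real (fun i ω => f (ξ i ω)) hi
    (fun i j hij => (hind.indepFun hij).comp hf hf)
    (fun i => IdentDistrib.comp ⟨(hmeas i).aemeasurable, (hmeas 0).aemeasurable,
      by rw [hmap, hmap]⟩ hf)
  have he : ∫ ω, f (ξ 0 ω) ∂P = ∫ t in Ioo 0 1, f t := by
    rw [← hmap 0, integral_map (hmeas 0).aemeasurable hf.aestronglyMeasurable]
  rwa [he] at h

theorem integral_indicator_Iio_comp (hmeas : ∀ i, Measurable (ξ i))
    (hmap : ∀ i, P.map (ξ i) = volume.restrict (Ioo 0 1)) {t : ℝ} (ht : t ∈ Icc (0 : ℝ) 1) (i : ℕ) :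
    ∫ ω, (Iio t).indicator (fun _ => (1 : ℝ)) (ξ i ω) ∂P = t := by
  have hf : Measurable ((Iio t).indicator fun _ => (1 : ℝ)) :=
    measurable_const.indicator measurableSet_Iio
  rw [← integral_map (hmeas i).aemeasurable hf.aestronglyMeasurable, hmap,
    integral_indicator measurableSet_Iio, Measure.restrict_restrict measurableSet_Iio]
  have : Iio t ∩ Ioo 0 1 = Ioo 0 t := by
    ext s
    simp only [mem_inter_iff, mem_Iio, mem_Ioo]
    exact ⟨fun h => ⟨h.2.1, h.1⟩, fun h => ⟨h.2, h.1, h.2.trans_le ht.2⟩⟩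
  rw [this]
  simp [ht.1]

/-- The number of indices `i < n` with `x i < t`. -/
def countLT (n : ℕ) (x : ℕ → ℝ) (t : ℝ) : ℕ := ((Finset.range n).filter fun i => x i < t).card

theorem countLT_mono (n : ℕ) (x : ℕ → ℝ) : Monotone (countLT n x) := fun _ _ h =>
  Finset.card_le_card (Finset.monotone_filter_right _ fun _ _ hi => lt_of_lt_of_le hi h)

theorem sum_indicator_Iio (n : ℕ) (x : ℕ → ℝ) (t : ℝ) :
    ∑ i ∈ Finset.range n, (Iio t).indicator (fun _ => (1 : ℝ)) (x i) = countLT n x t := by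
  simp only [countLT, Finset.card_filter, indicator_apply, mem_Iio]
  push_cast
  rfl

/-- Rational points keep the exceptional null sets countable in number; monotonicity of the counts
lets them control all other points. -/
theorem ae_tendsto_countLT (hmeas : ∀ i, Measurable (ξ i)) (hind : iIndepFun ξ P)
    (hmap : ∀ i, P.map (ξ i) = volume.restrict (Ioo 0 1)) :
    ∀ᵐ ω ∂P, ∀ q : ℚ, (q : ℝ) ∈ Ioo (0 : ℝ) 1 →
      Tendsto (fun n : ℕ => (countLT n (fun i => ξ i ω) q : ℝ) / n) atTop (𝓝 q) := by
  rw [ae_all_iff]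
  intro q
  have hf : Measurable ((Iio (q : ℝ)).indicator fun _ => (1 : ℝ)) :=
    measurable_const.indicator measurableSet_Iio
  have h := ae_tendsto_average hmeas hind hmap hf
    ((integrable_const (1 : ℝ)).indicator measurableSet_Iio)
  filter_upwards [h] with ω hω hq
  have he : ∫ t in Ioo 0 1, (Iio (q : ℝ)).indicator (fun _ => (1 : ℝ)) t = q := by
    rw [← hmap 0, integral_map (hmeas 0).aemeasurable hf.aestronglyMeasurable,
      integral_indicator_Iio_comp hmeas hmap ⟨hq.1.le, hq.2.le⟩]
  rw [he] at hω
  simpa only [sum_indicator_Iio] using hω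

variable [IsProbabilityMeasure P]

/-- Chernoff's bound at the parameter 1/L: since e^y ≤ 1 + 2y on [0,1], each moment generating
function is at most e^(2m/L). The explicit dependence on L matters because L later grows with n. -/
theorem measureReal_sum_ge_le {X : ℕ → Ω → ℝ} (hX : ∀ i, Measurable (X i)) (hind : iIndepFun X P)
    {L m : ℝ} (hL : 0 < L) (hb : ∀ i ω, X i ω ∈ Icc 0 L) (hm : ∀ i, ∫ ω, X i ω ∂P ≤ m) (n : ℕ) :
    P.real {ω | 4 * (n * m) ≤ ∑ i ∈ Finset.range n, X i ω} ≤ Real.exp (-(2 * (n * m) / L)) := by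
  have hint : ∀ i, Integrable (X i) P := fun i =>
    Integrable.of_mem_Icc 0 L (hX i).aemeasurable (Eventually.of_forall (hb i))
  have hmgf : ∀ i, mgf (X i) P (1 / L) ≤ Real.exp (2 * m / L) := by
    intro i
    calc mgf (X i) P (1 / L) ≤ ∫ ω, (1 + 2 / L * X i ω) ∂P := by
          refine integral_mono_of_nonneg (Eventually.of_forall fun ω => (Real.exp_pos _).le)
            ((integrable_const _).add ((hint i).const_mul _)) (Eventually.of_forall fun ω => ?_)
          have h0 : 0 ≤ 1 / L * X i ω := mul_nonneg (by positivity) (hb i ω).1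
          have h1 : 1 / L * X i ω ≤ 1 := by
            rw [one_div, inv_mul_le_iff₀ hL, mul_one]
            exact (hb i ω).2
          -- For 0 ≤ y ≤ 1 this gives e^y ≤ 1 + y + y² ≤ 1 + 2y.
          have := (abs_le.1 (Real.abs_exp_sub_one_sub_id_le (abs_le.2 ⟨by linarith, h1⟩))).2
          have h2 : 2 / L * X i ω = 2 * (1 / L * X i ω) := by ring
          simp only [h2]
          nlinarith
      _ = 1 + 2 / L * ∫ ω, X i ω ∂P := by
          rw [integral_add (integrable_const _) ((hint i).const_mul _), integral_const_mul]
          simp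
      _ ≤ 1 + 2 / L * m := by
          gcongr
          exact hm i
      _ ≤ Real.exp (2 * m / L) := by
          have := Real.add_one_le_exp (2 * m / L)
          have h2 : 2 / L * m = 2 * m / L := by ring
          linarith
  have hexp : Integrable (fun ω => Real.exp (1 / L * (∑ i ∈ Finset.range n, X i) ω)) P := by
    refine Integrable.of_mem_Icc 0 (Real.exp (1 / L * (n * L)))
      (by fun_prop) (Eventually.of_forall fun ω => ⟨(Real.exp_pos _).le, ?_⟩)
    gcongr
    simp only [Finset.sum_apply]
    calc ∑ i ∈ Finset.range n, X i ω ≤ ∑ i ∈ Finset.range n, L :=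
          Finset.sum_le_sum fun i _ => (hb i ω).2
      _ = n * L := by simp
  have h := measure_ge_le_exp_mul_mgf (μ := P) (X := ∑ i ∈ Finset.range n, X i)
    (4 * (n * m)) (by positivity : 0 ≤ 1 / L) hexp
  simp only [Finset.sum_apply] at h
  refine h.trans ?_
  rw [hind.mgf_sum hX]
  calc Real.exp (-(1 / L) * (4 * (n * m))) * ∏ i ∈ Finset.range n, mgf (X i) P (1 / L)
      ≤ Real.exp (-(1 / L) * (4 * (n * m))) * ∏ i ∈ Finset.range n, Real.exp (2 * m / L) := by
        gcongr with i hi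
        · exact fun i _ => mgf_nonneg
        · exact hmgf i
    _ = Real.exp (-(2 * (n * m) / L)) := by
        rw [Finset.prod_const, Finset.card_range, ← Real.exp_nat_mul, ← Real.exp_add]
        congr 1
        ring

/-- Chernoff's bound at the parameter -1, with e^(-y) ≤ 1 - y/2 on [0,1]. -/
theorem measureReal_sum_le_le {X : ℕ → Ω → ℝ} (hX : ∀ i, Measurable (X i)) (hind : iIndepFun X P)
    {m : ℝ} (hb : ∀ i ω, X i ω ∈ Icc 0 1) (hm : ∀ i, m ≤ ∫ ω, X i ω ∂P) (n : ℕ) :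
    P.real {ω | ∑ i ∈ Finset.range n, X i ω ≤ n * m / 4} ≤ Real.exp (-(n * m / 4)) := by
  have hint : ∀ i, Integrable (X i) P := fun i =>
    Integrable.of_mem_Icc 0 1 (hX i).aemeasurable (Eventually.of_forall (hb i))
  have hmgf : ∀ i, mgf (X i) P (-1) ≤ Real.exp (-(m / 2)) := by
    intro i
    calc mgf (X i) P (-1) ≤ ∫ ω, (1 - 1 / 2 * X i ω) ∂P := by
          refine integral_mono_of_nonneg (Eventually.of_forall fun ω => (Real.exp_pos _).le)
            ((integrable_const _).sub ((hint i).const_mul _)) (Eventually.of_forall fun ω => ?_)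
          obtain ⟨h0, h1⟩ := hb i ω
          have h2 := Real.add_one_le_exp (X i ω)
          simp only [neg_mul, one_mul, Real.exp_neg]
          rw [inv_le_iff_one_le_mul₀ (Real.exp_pos _)]
          -- The inequality follows from (1 - y/2)(1 + y) ≥ 1 for 0 ≤ y ≤ 1.
          nlinarith
      _ = 1 - 1 / 2 * ∫ ω, X i ω ∂P := by
          rw [integral_sub (integrable_const _) ((hint i).const_mul _), integral_const_mul]
          simp
      _ ≤ 1 - 1 / 2 * m := by
          gcongr
          exact hm i
      _ ≤ Real.exp (-(m / 2)) := by
          have := Real.add_one_le_exp (-(m / 2))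
          linarith
  have hexp : Integrable (fun ω => Real.exp (-1 * (∑ i ∈ Finset.range n, X i) ω)) P := by
    refine Integrable.of_mem_Icc 0 1
      (by fun_prop) (Eventually.of_forall fun ω => ⟨(Real.exp_pos _).le, ?_⟩)
    rw [Real.exp_le_one_iff]
    simp only [Finset.sum_apply]
    have := Finset.sum_nonneg (s := Finset.range n) fun i _ => (hb i ω).1
    linarith
  have h := measure_le_le_exp_mul_mgf (μ := P) (X := ∑ i ∈ Finset.range n, X i)
    (n * m / 4) (by norm_num : (-1 : ℝ) ≤ 0) hexp
  simp only [Finset.sum_apply] at h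
  refine h.trans ?_
  rw [hind.mgf_sum hX]
  calc Real.exp (-(-1) * (n * m / 4)) * ∏ i ∈ Finset.range n, mgf (X i) P (-1)
      ≤ Real.exp (-(-1) * (n * m / 4)) * ∏ i ∈ Finset.range n, Real.exp (-(m / 2)) := by
        gcongr with i hi
        · exact fun i _ => mgf_nonneg
        · exact hmgf i
    _ = Real.exp (-(n * m / 4)) := by
        rw [Finset.prod_const, Finset.card_range, ← Real.exp_nat_mul, ← Real.exp_add]
        congr 1
        ring

/-- Borel–Cantelli; the factor n + 1 leaves room for a union bound over a grid of n + 1 points. -/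
theorem ae_eventually_notMem_of_exp_bound {A : ℕ → Set Ω} {c r : ℝ} (hc : 0 < c) (hr : 0 < r)
    (hA : ∀ᶠ n : ℕ in atTop, P.real (A n) ≤ ((n : ℝ) + 1) * Real.exp (-(c * (n : ℝ) ^ r))) :
    ∀ᵐ ω ∂P, ∀ᶠ n in atTop, ω ∉ A n := by
  have hs : Summable fun n => P.real (A n) := by
    refine summable_of_isBigO_nat (summable_mul_exp_neg_rpow hc hr)
      (Asymptotics.IsBigO.of_bound 1 ?_)
    filter_upwards [hA] with n hn
    rw [Real.norm_of_nonneg measureReal_nonneg, Real.norm_of_nonneg (by positivity), one_mul]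
    exact hn
  refine ae_eventually_notMem ?_
  have h := hs.tsum_ofReal_ne_top
  simpa [ofReal_measureReal] using h

theorem measureReal_countLT_le (hmeas : ∀ i, Measurable (ξ i)) (hind : iIndepFun ξ P)
    (hmap : ∀ i, P.map (ξ i) = volume.restrict (Ioo 0 1)) {t : ℝ} (ht : t ∈ Icc (0 : ℝ) 1) (n : ℕ) :
    P.real {ω | (countLT n (fun i => ξ i ω) t : ℝ) ≤ n * t / 4} ≤ Real.exp (-(n * t / 4)) := by
  have hf : Measurable ((Iio t).indicator fun _ => (1 : ℝ)) :=
    measurable_const.indicator measurableSet_Iio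
  have h := measureReal_sum_le_le (P := P)
    (X := fun i ω => (Iio t).indicator (fun _ => (1 : ℝ)) (ξ i ω))
    (fun i => hf.comp (hmeas i)) (hind.comp _ fun _ => hf) (m := t)
    (fun i ω => by
      simp only [indicator_apply]
      split_ifs <;> simp)
    (fun i => (integral_indicator_Iio_comp hmeas hmap ht i).ge) n
  simpa only [sum_indicator_Iio] using h

/-- On a grid of mesh `1/n`, a lower bound for the counts carries over to all points of `(0,1)`. -/
theorem rpow_le_of_grid {n : ℕ} (hn : 1 ≤ n) {x : ℕ → ℝ} {η : ℝ} (hη : 0 < η)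
    (h : ∀ j ∈ Finset.range (n + 1), 1 ≤ (n : ℝ) * ((j : ℝ) / n) ^ (1 + η) →
      (n : ℝ) * ((j : ℝ) / n) / 4 ≤ countLT n x ((j : ℝ) / n)) {t : ℝ} (ht : t ∈ Ioo (0 : ℝ) 1) :
    t ^ (1 + η) ≤ 4 * 2 ^ (1 + η) * (((countLT n x t : ℝ) + 1) / n) := by
  have hn0 : (0 : ℝ) < n := by exact_mod_cast hn
  have h2 : (1 : ℝ) ≤ 2 ^ (1 + η) := Real.one_le_rpow (by norm_num) (by linarith)
  set j := ⌊(n : ℝ) * t⌋₊ with hj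
  have hnt : 0 ≤ (n : ℝ) * t := mul_nonneg hn0.le ht.1.le
  have hj1 : (j : ℝ) ≤ n * t := Nat.floor_le hnt
  have hj2 : (n : ℝ) * t < j + 1 := Nat.lt_floor_add_one _
  have hjt : (j : ℝ) / n ≤ t := by
    rw [div_le_iff₀ hn0]
    linarith
  have hc0 : (0 : ℝ) ≤ countLT n x t := Nat.cast_nonneg _
  -- Below the first positive grid point, t ≤ 1/n and the summand 1 next to the count suffices.
  -- Otherwise t ≤ (j+1)/n ≤ 2j/n, which is the origin of the factor 2^(1+η).
  rcases Nat.eq_zero_or_pos j with h0 | hpos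
  · have htn : t ≤ 1 / n := by
      rw [le_div_iff₀ hn0]
      rw [h0] at hj2
      simp at hj2
      linarith
    calc t ^ (1 + η) ≤ t ^ (1 : ℝ) := Real.rpow_le_rpow_of_exponent_ge ht.1 ht.2.le (by linarith)
      _ = t := Real.rpow_one t
      _ ≤ 1 * (1 / n) := by linarith
      _ ≤ 4 * 2 ^ (1 + η) * (((countLT n x t : ℝ) + 1) / n) := by
          gcongr
          · linarith
          · linarith
  · have hjpos : (1 : ℝ) ≤ j := by exact_mod_cast hpos
    have ht2 : t ≤ 2 * ((j : ℝ) / n) := by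
      rw [mul_div_assoc', le_div_iff₀ hn0]
      linarith
    have h3 : t ^ (1 + η) ≤ 2 ^ (1 + η) * ((j : ℝ) / n) ^ (1 + η) := by
      rw [← Real.mul_rpow (by norm_num) (by positivity)]
      exact Real.rpow_le_rpow ht.1.le ht2 (by linarith)
    refine h3.trans ?_
    rw [mul_comm (4 : ℝ), mul_assoc]
    gcongr
    rw [mul_div_assoc', le_div_iff₀ hn0]
    by_cases hcase : 1 ≤ (n : ℝ) * ((j : ℝ) / n) ^ (1 + η)
    · have hjn : j ∈ Finset.range (n + 1) := by
        rw [Finset.mem_range, Nat.lt_succ_iff]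
        have : (j : ℝ) ≤ n := hj1.trans (by nlinarith [ht.2])
        exact_mod_cast this
      have h4 := h j hjn hcase
      have h5 : (countLT n x ((j : ℝ) / n) : ℝ) ≤ countLT n x t := by
        exact_mod_cast countLT_mono n x hjt
      have h6 : ((j : ℝ) / n) ^ (1 + η) ≤ ((j : ℝ) / n) ^ (1 : ℝ) :=
        Real.rpow_le_rpow_of_exponent_ge (by positivity) (hjt.trans ht.2.le) (by linarith)
      rw [Real.rpow_one] at h6
      have h7 := mul_le_mul_of_nonneg_right h6 hn0.le
      linarith
    · push Not at hcase
      linarith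

/-- The exponent 1 + η buys the exponential rate. Grid points with n t^(1+η) ≥ 1 satisfy nt ≥
n^(1-1/(1+η)), so the probability of too small a count there decays like the exponential of a power
of n and survives the union bound. At smaller grid points the summand 1 suffices. -/
theorem ae_eventually_rpow_le_countLT (hmeas : ∀ i, Measurable (ξ i)) (hind : iIndepFun ξ P)
    (hmap : ∀ i, P.map (ξ i) = volume.restrict (Ioo 0 1)) {η : ℝ} (hη : 0 < η) :
    ∀ᵐ ω ∂P, ∀ᶠ n : ℕ in atTop, ∀ t ∈ Ioo (0 : ℝ) 1,
      t ^ (1 + η) ≤ 4 * 2 ^ (1 + η) * (((countLT n (fun i => ξ i ω) t : ℝ) + 1) / n) := by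
  have hr : 0 < 1 - 1 / (1 + η) := by
    rw [sub_pos, div_lt_one (by linarith)]
    linarith
  have key := ae_eventually_notMem_of_exp_bound (P := P) (c := 1 / 4) (by norm_num) hr
    (A := fun n : ℕ => ⋃ j ∈ (Finset.range (n + 1)).filter
      fun j : ℕ => 1 ≤ (n : ℝ) * ((j : ℝ) / n) ^ (1 + η),
      {ω | (countLT n (fun i => ξ i ω) ((j : ℝ) / n) : ℝ) ≤ n * ((j : ℝ) / n) / 4}) ?_
  · filter_upwards [key] with ω hω
    filter_upwards [hω, eventually_ge_atTop 1] with n hn hn1 t ht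
    refine rpow_le_of_grid hn1 hη (fun j hj hj1 => ?_) ht
    by_contra! hlt
    exact hn (mem_biUnion (Finset.mem_coe.2 (Finset.mem_filter.2 ⟨hj, hj1⟩)) hlt.le)
  · filter_upwards [eventually_ge_atTop 1] with n hn
    have hn0 : (0 : ℝ) < n := by exact_mod_cast hn
    refine (measureReal_biUnion_finset_le _ _).trans ?_
    calc ∑ j ∈ (Finset.range (n + 1)).filter
          fun j : ℕ => 1 ≤ (n : ℝ) * ((j : ℝ) / n) ^ (1 + η),
          P.real {ω | (countLT n (fun i => ξ i ω) ((j : ℝ) / n) : ℝ) ≤ n * ((j : ℝ) / n) / 4}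
        ≤ ∑ j ∈ (Finset.range (n + 1)).filter
          fun j : ℕ => 1 ≤ (n : ℝ) * ((j : ℝ) / n) ^ (1 + η),
            Real.exp (-(1 / 4 * (n : ℝ) ^ (1 - 1 / (1 + η)))) := by
          refine Finset.sum_le_sum fun j hj => ?_
          obtain ⟨hj1, hj2⟩ := Finset.mem_filter.1 hj
          have hjn : (j : ℝ) ≤ n := by exact_mod_cast Nat.lt_succ_iff.1 (Finset.mem_range.1 hj1)
          have ht : (j : ℝ) / n ∈ Icc (0 : ℝ) 1 :=
            ⟨by positivity, by rw [div_le_one hn0]; exact hjn⟩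
          refine (measureReal_countLT_le hmeas hind hmap ht n).trans ?_
          have h1 : (n : ℝ) ^ (-(1 / (1 + η))) ≤ (j : ℝ) / n := by
            have h2 : (n : ℝ)⁻¹ ≤ ((j : ℝ) / n) ^ (1 + η) := by
              rw [inv_le_iff_one_le_mul₀' hn0]
              exact hj2
            have h3 := Real.rpow_le_rpow (by positivity) h2
              (by positivity : 0 ≤ 1 / (1 + η))
            rw [← Real.rpow_mul ht.1, mul_one_div_cancel (by linarith), Real.rpow_one,
              Real.inv_rpow hn0.le, ← Real.rpow_neg hn0.le] at h3
            exact h3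
          have h4 : (n : ℝ) ^ (1 - 1 / (1 + η)) ≤ n * ((j : ℝ) / n) := by
            rw [sub_eq_add_neg, Real.rpow_add hn0, Real.rpow_one]
            gcongr
          rw [Real.exp_le_exp]
          linarith
      _ ≤ _ := by
          rw [Finset.sum_const, nsmul_eq_mul]
          gcongr
          calc (((Finset.range (n + 1)).filter
                fun j : ℕ => 1 ≤ (n : ℝ) * ((j : ℝ) / n) ^ (1 + η)).card : ℝ)
              ≤ ((Finset.range (n + 1)).card : ℝ) := by exact_mod_cast Finset.card_filter_le _ _
            _ = n + 1 := by simp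

end Probability

/-! ### Kernel smoothing -/

/-- The kernel `k` rescaled to the bandwidth `b` and centred at `x`. -/
def scaledKernel (k : ℝ → ℝ) (b x t : ℝ) : ℝ := 1 / b * k ((t - x) / b)

section Scaled

variable {k : ℝ → ℝ} {b : ℝ}

theorem integrable_scaledKernel (hk : IsKernel k) (hb : 0 < b) (x : ℝ) :
    Integrable (scaledKernel k b x) :=
  ((hk.integrable.comp_div hb.ne').comp_sub_right x).const_mul _

theorem integral_scaledKernel (hk : IsKernel k) (hb : 0 < b) (x : ℝ) :
    ∫ t, scaledKernel k b x t = 1 := by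
  simp only [scaledKernel]
  rw [integral_const_mul, integral_sub_right_eq_self (fun t => k (t / b)) x,
    Measure.integral_comp_div, hk.integral_eq_one, abs_of_pos hb]
  simp [hb.ne']

theorem integrable_scaledKernel_swap (hk : IsKernel k) (hb : 0 < b) (t : ℝ) :
    Integrable fun x => scaledKernel k b x t :=
  ((hk.integrable.comp_div hb.ne').comp_sub_left t).const_mul _

theorem integral_scaledKernel_swap (hk : IsKernel k) (hb : 0 < b) (t : ℝ) :
    ∫ x, scaledKernel k b x t = 1 := by
  simp only [scaledKernel]
  rw [integral_const_mul, integral_sub_left_eq_self (fun t => k (t / b)) volume t,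
    Measure.integral_comp_div, hk.integral_eq_one, abs_of_pos hb]
  simp [hb.ne']

theorem scaledKernel_nonneg (hk : IsKernel k) (hb : 0 < b) (x t : ℝ) : 0 ≤ scaledKernel k b x t :=
  mul_nonneg (by positivity) (hk.nonneg _)

theorem scaledKernel_le {κ : ℝ} (hκ : ∀ x, k x ≤ κ) (hb : 0 < b) (x t : ℝ) :
    scaledKernel k b x t ≤ 1 / b * κ := by
  unfold scaledKernel
  gcongr
  exact hκ _

theorem measurable_uncurry_scaledKernel (hk : Measurable k) (b : ℝ) :
    Measurable fun p : ℝ × ℝ => scaledKernel k b p.1 p.2 := by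
  unfold scaledKernel
  fun_prop

/-- The kernel smoothing `∫ W(t) b⁻¹ k((t - x)/b) dt` of a function `W`. -/
def smoothing (k W : ℝ → ℝ) (b x : ℝ) : ℝ := ∫ t, W t * scaledKernel k b x t

theorem integrable_mul_scaledKernel (hk : IsKernel k) (hb : 0 < b) {W : ℝ → ℝ}
    (hW : Integrable W) (x : ℝ) : Integrable fun t => W t * scaledKernel k b x t := by
  obtain ⟨κ, hκ⟩ := hk.bounded
  refine hW.mul_bdd (c := 1 / b * κ) (integrable_scaledKernel hk hb x).aestronglyMeasurable
    (Eventually.of_forall fun t => ?_)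
  rw [Real.norm_of_nonneg (scaledKernel_nonneg hk hb x t)]
  exact scaledKernel_le hκ hb x t

theorem smoothing_nonneg (hk : IsKernel k) (hb : 0 < b) {W : ℝ → ℝ} (hW : ∀ t, 0 ≤ W t) (x : ℝ) :
    0 ≤ smoothing k W b x :=
  integral_nonneg fun t => mul_nonneg (hW t) (scaledKernel_nonneg hk hb x t)

theorem measurable_smoothing (hk : Measurable k) {W : ℝ → ℝ} (hW : Measurable W) (b : ℝ) :
    Measurable (smoothing k W b) := by
  have h : Measurable fun p : ℝ × ℝ => W p.2 * scaledKernel k b p.1 p.2 :=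
    (hW.comp measurable_snd).mul (measurable_uncurry_scaledKernel hk b)
  exact h.stronglyMeasurable.integral_prod_right'.measurable

/-- Split W at the level R = n^(1/q). The part below R contributes at most R, because the kernel has
mass one. The excess is at most R^(1-q) W^q, and the kernel is at most κ/b ≤ nκ; since R^q = n, both
parts are of order R. The point is that n^(1/q) is of smaller order than n, so the Chernoff bound is
summable. -/
theorem smoothing_le (hk : IsKernel k) {κ : ℝ} (hκ : ∀ x, k x ≤ κ) {W : ℝ → ℝ}
    (hW : Integrable W) (hW0 : ∀ t, 0 ≤ W t) {q : ℝ} (hq : 1 < q)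
    (hWq : Integrable fun t => W t ^ q) {n : ℝ} (hn : 0 < n) (hb : 0 < b) (hnb : 1 ≤ n * b)
    (x : ℝ) : smoothing k W b x ≤ n ^ (1 / q) * (1 + κ * ∫ t, W t ^ q) := by
  have hκ0 : 0 ≤ κ := (hk.nonneg 0).trans (hκ 0)
  set R := n ^ (1 / q) with hR
  have hR0 : 0 < R := Real.rpow_pos_of_pos hn _
  have hpt : ∀ t, W t ≤ R + R ^ (1 - q) * W t ^ q := by
    intro t
    rcases le_total (W t) R with h | h
    · linarith [mul_nonneg (Real.rpow_nonneg hR0.le (1 - q)) (Real.rpow_nonneg (hW0 t) q)]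
    · have hWt : 0 < W t := hR0.trans_le h
      calc W t = W t ^ (1 - q) * W t ^ q := by
            rw [← Real.rpow_add hWt]
            simp
        _ ≤ R ^ (1 - q) * W t ^ q := by
            gcongr ?_ * _
            exact Real.rpow_le_rpow_of_nonpos hR0 h (by linarith)
        _ ≤ R + R ^ (1 - q) * W t ^ q := by linarith
  have hb' : 1 / b ≤ n := by
    rw [div_le_iff₀ hb]
    exact hnb
  have hRn : R ^ (1 - q) * n = R := by
    have : n = R ^ q := by
      rw [hR, ← Real.rpow_mul hn.le, one_div_mul_cancel (by linarith), Real.rpow_one]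
    conv_lhs => rw [this]
    rw [← Real.rpow_add hR0]
    simp
  calc smoothing k W b x
      ≤ ∫ t, (R * scaledKernel k b x t + R ^ (1 - q) * (n * κ) * W t ^ q) := by
        refine integral_mono (integrable_mul_scaledKernel hk hb hW x)
          (((integrable_scaledKernel hk hb x).const_mul _).add (hWq.const_mul _)) fun t => ?_
        have h0 := scaledKernel_nonneg hk hb x t
        have h1 : scaledKernel k b x t ≤ n * κ :=
          (scaledKernel_le hκ hb x t).trans (by gcongr)
        calc W t * scaledKernel k b x t
            ≤ (R + R ^ (1 - q) * W t ^ q) * scaledKernel k b x t := by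
              gcongr
              exact hpt t
          _ = R * scaledKernel k b x t + R ^ (1 - q) * W t ^ q * scaledKernel k b x t := by ring
          _ ≤ R * scaledKernel k b x t + R ^ (1 - q) * W t ^ q * (n * κ) := by
              have := Real.rpow_nonneg (hW0 t) q
              gcongr
          _ = _ := by ring
    _ = R + R ^ (1 - q) * n * (κ * ∫ t, W t ^ q) := by
        rw [integral_add ((integrable_scaledKernel hk hb x).const_mul _) (hWq.const_mul _),
          integral_const_mul, integral_const_mul, integral_scaledKernel hk hb]
        ring
    _ = R * (1 + κ * ∫ t, W t ^ q) := by
        rw [hRn]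
        ring

theorem ofReal_smoothing (hk : IsKernel k) (hb : 0 < b) {W : ℝ → ℝ}
    (hW : Integrable W) (hW0 : ∀ t, 0 ≤ W t) (x : ℝ) :
    ENNReal.ofReal (smoothing k W b x) =
      ∫⁻ t, ENNReal.ofReal (W t) * ENNReal.ofReal (scaledKernel k b x t) := by
  rw [smoothing, ofReal_integral_eq_lintegral_ofReal (integrable_mul_scaledKernel hk hb hW x)
    (Eventually.of_forall fun t => mul_nonneg (hW0 t) (scaledKernel_nonneg hk hb x t))]
  simp only [ENNReal.ofReal_mul (hW0 _)]

/-- Tonelli: the scaled kernel also has integral one as a function of its centre. -/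
theorem integral_smoothing_le (hk : IsKernel k) (hkm : Measurable k) (hb : 0 < b) {W : ℝ → ℝ}
    (hWm : Measurable W) (hW : Integrable W) (hW0 : ∀ t, 0 ≤ W t) (s : Set ℝ) :
    ∫ x in s, smoothing k W b x ≤ ∫ t, W t := by
  rw [integral_eq_lintegral_of_nonneg_ae
    (Eventually.of_forall fun x => smoothing_nonneg hk hb hW0 x)
    (measurable_smoothing hkm hWm b).aestronglyMeasurable,
    integral_eq_lintegral_of_nonneg_ae (Eventually.of_forall hW0) hW.aestronglyMeasurable]
  refine ENNReal.toReal_mono ?_ ?_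
  · rw [← ofReal_integral_eq_lintegral_ofReal hW (Eventually.of_forall hW0)]
    exact ENNReal.ofReal_ne_top
  · calc ∫⁻ x in s, ENNReal.ofReal (smoothing k W b x)
        ≤ ∫⁻ x, ENNReal.ofReal (smoothing k W b x) := setLIntegral_le_lintegral _ _
      _ = ∫⁻ x, ∫⁻ t, ENNReal.ofReal (W t) * ENNReal.ofReal (scaledKernel k b x t) := by
          simp only [ofReal_smoothing hk hb hW hW0]
      _ = ∫⁻ t, ∫⁻ x, ENNReal.ofReal (W t) * ENNReal.ofReal (scaledKernel k b x t) := by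
          refine lintegral_lintegral_swap (Measurable.aemeasurable ?_)
          exact ((hWm.comp measurable_snd).ennreal_ofReal).mul
            (measurable_uncurry_scaledKernel hkm b).ennreal_ofReal
      _ = ∫⁻ t, ENNReal.ofReal (W t) := by
          refine lintegral_congr fun t => ?_
          rw [lintegral_const_mul' _ _ ENNReal.ofReal_ne_top,
            ← ofReal_integral_eq_lintegral_ofReal (integrable_scaledKernel_swap hk hb t)
              (Eventually.of_forall fun x => scaledKernel_nonneg hk hb x t),
            integral_scaledKernel_swap hk hb]
          simp

end Scaled

/-- The summands change with n through the bandwidth, so the strong law does not apply directly.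
They are bounded by a multiple of n^(1/q), and the Chernoff bound gives a probability exp(-c
n^(1-1/q)). -/
theorem ae_eventually_average_smoothing_le {Ω : Type*} [MeasurableSpace Ω] {P : Measure Ω}
    [IsProbabilityMeasure P] {ξ : ℕ → Ω → ℝ} (hmeas : ∀ i, Measurable (ξ i))
    (hind : iIndepFun ξ P) (hmap : ∀ i, P.map (ξ i) = volume.restrict (Ioo 0 1))
    {k : ℝ → ℝ} (hk : IsKernel k) (hkm : Measurable k) {b : ℕ → ℝ} (hb : IsBandwidth b)
    {W : ℝ → ℝ} (hWm : Measurable W) (hW : Integrable W) (hW0 : ∀ t, 0 ≤ W t) {q : ℝ} (hq : 1 < q)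
    (hWq : Integrable fun t => W t ^ q) :
    ∀ᵐ ω ∂P, ∀ᶠ n : ℕ in atTop,
      1 / (n : ℝ) * ∑ i ∈ Finset.range n, smoothing k W (b n) (ξ i ω) ≤ 4 * ((∫ t, W t) + 1) := by
  obtain ⟨κ, hκ⟩ := hk.bounded
  have hκ0 : 0 ≤ κ := (hk.nonneg 0).trans (hκ 0)
  have hI : 0 ≤ ∫ t, W t ^ q := integral_nonneg fun t => Real.rpow_nonneg (hW0 t) q
  have hm : 0 < (∫ t, W t) + 1 := by
    have : 0 ≤ ∫ t, W t := integral_nonneg hW0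
    linarith
  -- The added 1 keeps the threshold positive even if W vanishes almost everywhere.
  set m := (∫ t, W t) + 1 with hmdef
  set C := 1 + κ * ∫ t, W t ^ q with hC
  have hC0 : 0 < C := by positivity
  have hr : 0 < 1 - 1 / q := by
    rw [sub_pos, div_lt_one (by linarith)]
    exact hq
  have key := ae_eventually_notMem_of_exp_bound (P := P) (c := 2 * m / C) (by positivity) hr
    (A := fun n : ℕ =>
      {ω | 4 * (n * m) ≤ ∑ i ∈ Finset.range n, smoothing k W (b n) (ξ i ω)}) ?_
  · filter_upwards [key] with ω hω
    filter_upwards [hω, eventually_ge_atTop 1] with n hn hn1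
    have hn0 : (0 : ℝ) < n := by exact_mod_cast hn1
    replace hn := not_le.1 hn
    rw [one_div, inv_mul_le_iff₀ hn0]
    linarith
  · filter_upwards [eventually_ge_atTop 1, hb.tendsto_atTop.eventually_ge_atTop 1] with n hn hnb
    have hn0 : (0 : ℝ) < n := by exact_mod_cast hn
    have hbn := hb.pos n hn
    have hms := measurable_smoothing hkm hWm (b n)
    refine (measureReal_sum_ge_le (P := P) (X := fun i ω => smoothing k W (b n) (ξ i ω))
      (L := (n : ℝ) ^ (1 / q) * C)
      (fun i => hms.comp (hmeas i)) (hind.comp _ fun _ => hms) (by positivity)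
      (fun i ω => ⟨smoothing_nonneg hk hbn hW0 _, smoothing_le hk hκ hW hW0 hq hWq hn0 hbn hnb _⟩)
      (fun i => ?_) n).trans ?_
    · rw [← integral_map (hmeas i).aemeasurable hms.aestronglyMeasurable, hmap]
      exact (integral_smoothing_le hk hkm hbn hWm hW hW0 _).trans (by linarith)
    · have he : 2 * ((n : ℝ) * m) / ((n : ℝ) ^ (1 / q) * C) =
          2 * m / C * (n : ℝ) ^ (1 - 1 / q) := by
        rw [Real.rpow_sub hn0, Real.rpow_one]
        field_simp
      rw [he]
      refine le_mul_of_one_le_left (Real.exp_pos _).le (by linarith)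

/-! ### The kernel estimator -/

section Estimator

variable {k : ℝ → ℝ}

theorem kernelDF_nonneg (hk : IsKernel k) (x : ℝ) : 0 ≤ kernelDF k x :=
  setIntegral_nonneg measurableSet_Iic fun t _ => hk.nonneg t

theorem kernelDF_mono (hk : IsKernel k) : Monotone (kernelDF k) := fun _ _ hxy =>
  setIntegral_mono_set hk.integrable.integrableOn (Eventually.of_forall hk.nonneg)
    (Iic_subset_Iic.2 hxy).eventuallyLE

theorem kernelDF_le_one (hk : IsKernel k) (x : ℝ) : kernelDF k x ≤ 1 := by
  rw [← hk.integral_eq_one]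
  exact setIntegral_le_integral hk.integrable (Eventually.of_forall hk.nonneg)

theorem tendsto_kernelDF_atTop (hk : IsKernel k) : Tendsto (kernelDF k) atTop (𝓝 1) := by
  have := (aecover_Iic (μ := (volume : Measure ℝ)) tendsto_id).integral_tendsto_of_countably_generated
    hk.integrable
  rwa [hk.integral_eq_one] at this

theorem kernelDF_add_integral_Ioi (hk : IsKernel k) (x : ℝ) :
    kernelDF k x + ∫ t in Ioi x, k t = 1 := by
  rw [kernelDF, intervalIntegral.integral_Iic_add_Ioi hk.integrable.integrableOn
    hk.integrable.integrableOn, hk.integral_eq_one]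

theorem tendsto_kernelDF_atBot (hk : IsKernel k) : Tendsto (kernelDF k) atBot (𝓝 0) := by
  have h := (aecover_Ioi (μ := (volume : Measure ℝ))
    (tendsto_id (α := ℝ) (x := atBot))).integral_tendsto_of_countably_generated hk.integrable
  rw [hk.integral_eq_one] at h
  have h2 := (tendsto_const_nhds (x := (1 : ℝ))).sub h
  rw [sub_self] at h2
  refine h2.congr fun x => ?_
  have := kernelDF_add_integral_Ioi hk x
  simp only [id]
  linarith

/-- This is where the zero mean enters: without mass on the left, x k(x) would be nonnegative with
integral zero, so k would vanish almost everywhere. Positivity of K(0) and of 1 - K(0) lets counts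
be compared with the kernel estimator at the same point. -/
theorem kernelDF_zero_pos (hk : IsKernel k) : 0 < kernelDF k 0 := by
  refine (kernelDF_nonneg hk 0).lt_of_ne' fun h0 => ?_
  have h1 : ∀ᵐ x, x ∈ Iic (0 : ℝ) → k x = 0 := by
    have := (setIntegral_eq_zero_iff_of_nonneg_ae (Eventually.of_forall hk.nonneg)
      hk.integrable.integrableOn).1 h0
    exact (ae_restrict_iff' measurableSet_Iic).1 this
  have h2 : ∀ᵐ x, x * k x = 0 := by
    refine (integral_eq_zero_iff_of_nonneg_ae ?_ hk.integrable_mean).1 hk.mean_eq_zero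
    filter_upwards [h1] with x hx
    rcases le_or_gt x 0 with h | h
    · simp [hx h]
    · exact mul_nonneg h.le (hk.nonneg x)
  have h3 : k =ᵐ[volume] 0 := by
    filter_upwards [h1, h2] with x hx hx2
    rcases mul_eq_zero.1 hx2 with h | h
    · exact hx (by simp [h])
    · exact h
  have := hk.integral_eq_one
  rw [integral_congr_ae h3] at this
  simp at this

theorem kernelDF_zero_lt_one (hk : IsKernel k) : kernelDF k 0 < 1 := by
  refine (kernelDF_le_one hk 0).lt_of_ne fun h0 => ?_
  have h0' : ∫ t in Ioi (0 : ℝ), k t = 0 := by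
    have := kernelDF_add_integral_Ioi hk 0
    linarith
  have h1 : ∀ᵐ x, x ∈ Ioi (0 : ℝ) → k x = 0 := by
    have := (setIntegral_eq_zero_iff_of_nonneg_ae (Eventually.of_forall hk.nonneg)
      hk.integrable.integrableOn).1 h0'
    exact (ae_restrict_iff' measurableSet_Ioi).1 this
  have h2 : ∀ᵐ x, -(x * k x) = 0 := by
    refine (integral_eq_zero_iff_of_nonneg_ae ?_ hk.integrable_mean.neg).1
      (by simp only [Pi.neg_apply]; rw [integral_neg, hk.mean_eq_zero, neg_zero])
    filter_upwards [h1] with x hx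
    rcases le_or_gt x 0 with h | h
    · have := mul_nonneg (neg_nonneg.2 h) (hk.nonneg x)
      simp only [Pi.zero_apply, Pi.neg_apply]
      linarith
    · simp [hx h]
  have h3 : k =ᵐ[volume] 0 := by
    filter_upwards [h1, h2, compl_mem_ae_iff.2 (measure_singleton (0 : ℝ))] with x hx hx2 hx3
    rcases mul_eq_zero.1 (neg_eq_zero.1 hx2) with h | h
    · exact absurd h hx3
    · exact h
  have := hk.integral_eq_one
  rw [integral_congr_ae h3] at this
  simp at this

theorem setIntegral_Iic_scaled (k : ℝ → ℝ) {b : ℝ} (hb : 0 < b) (x t : ℝ) :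
    ∫ y in Iic t, k ((y - x) / b) = b * kernelDF k ((t - x) / b) := by
  have h : ∀ y, (Iic t).indicator (fun y => k ((y - x) / b)) y =
      (Iic ((t - x) / b)).indicator k ((y - x) / b) := by
    intro y
    simp only [indicator_apply, mem_Iic, div_le_div_iff_of_pos_right hb, sub_le_sub_iff_right]
  rw [← integral_indicator measurableSet_Iic, kernelDF, ← integral_indicator measurableSet_Iic]
  simp only [h]
  rw [integral_sub_right_eq_self (fun y => (Iic ((t - x) / b)).indicator k (y / b)) x,
    Measure.integral_comp_div, abs_of_pos hb, smul_eq_mul]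

theorem kernelEst_eq (k : ℝ → ℝ) {b : ℝ} (hb : 0 < b) (n : ℕ) (x : ℕ → ℝ) (t : ℝ) :
    kernelEst k b n x t = 1 / (n : ℝ) * ∑ i ∈ Finset.range n, kernelDF k ((t - x i) / b) := by
  simp only [kernelEst, setIntegral_Iic_scaled k hb, ← Finset.mul_sum]
  field_simp

/-- A kernel may be replaced by a Borel measurable one with the same distribution function. -/
theorem IsKernel.exists_measurable (hk : IsKernel k) :
    ∃ k', IsKernel k' ∧ Measurable k' ∧ kernelDF k' = kernelDF k := by
  obtain ⟨κ, hκ⟩ := hk.bounded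
  have hκ0 : 0 ≤ κ := (hk.nonneg 0).trans (hκ 0)
  have hm := hk.integrable.aestronglyMeasurable.aemeasurable
  -- Clamping to [0, κ] restores at every point the bounds that a measurable version has only almost
  -- everywhere.
  let k' : ℝ → ℝ := fun x => max 0 (min κ (hm.mk k x))
  have hae : k' =ᵐ[volume] k := by
    filter_upwards [hm.ae_eq_mk] with x hx
    simp only [k', ← hx]
    rw [min_eq_right (hκ x), max_eq_right (hk.nonneg x)]
  have hDF : kernelDF k' = kernelDF k := by
    funext x
    exact integral_congr_ae (ae_restrict_of_ae hae)
  refine ⟨k', ⟨fun x => le_max_left _ _, hk.integrable.congr hae.symm, ?_,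
    ⟨κ, fun x => max_le hκ0 (min_le_left _ _)⟩, hDF ▸ hk.differentiable, ?_, ?_, ?_⟩, ?_, hDF⟩
  · rw [integral_congr_ae hae, hk.integral_eq_one]
  · exact hk.integrable_mean.congr (by filter_upwards [hae] with x hx; rw [hx])
  · rw [← hk.mean_eq_zero]
    exact integral_congr_ae (by filter_upwards [hae] with x hx; simp only [hx])
  · exact hk.integrable_variance.congr (by filter_upwards [hae] with x hx; rw [hx])
  · exact measurable_const.max (measurable_const.min hm.measurable_mk)

variable {b : ℝ} {n : ℕ}

theorem kernelEst_mono (hk : IsKernel k) (hb : 0 < b) (n : ℕ) (x : ℕ → ℝ) :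
    Monotone (kernelEst k b n x) := by
  intro s t hst
  simp only [kernelEst_eq k hb]
  gcongr with i hi
  exact kernelDF_mono hk (by gcongr)

theorem continuous_kernelEst (hk : IsKernel k) (hb : 0 < b) (n : ℕ) (x : ℕ → ℝ) :
    Continuous (kernelEst k b n x) := by
  have := hk.differentiable.continuous
  simp only [funext (kernelEst_eq k hb n x)]
  fun_prop

theorem tendsto_kernelEst {l : Filter ℝ} {a : ℝ} (hb : 0 < b) (hn : 1 ≤ n) (x : ℕ → ℝ)
    (h : ∀ z, Tendsto (fun t => kernelDF k ((t - z) / b)) l (𝓝 a)) :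
    Tendsto (kernelEst k b n x) l (𝓝 a) := by
  have hn0 : (n : ℝ) ≠ 0 := by exact_mod_cast (by omega : n ≠ 0)
  have h1 := (tendsto_finsetSum (Finset.range n) fun i _ => h (x i)).const_mul (1 / (n : ℝ))
  have h2 : 1 / (n : ℝ) * ∑ i ∈ Finset.range n, a = a := by
    simp only [Finset.sum_const, Finset.card_range, nsmul_eq_mul]
    field_simp
  rw [h2] at h1
  exact h1.congr fun t => (kernelEst_eq k hb n x t).symm

theorem tendsto_kernelEst_atBot (hk : IsKernel k) (hb : 0 < b) (hn : 1 ≤ n) (x : ℕ → ℝ) :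
    Tendsto (kernelEst k b n x) atBot (𝓝 0) := by
  refine tendsto_kernelEst hb hn x fun z => (tendsto_kernelDF_atBot hk).comp ?_
  exact (tendsto_atBot_add_const_right _ (-z) tendsto_id).atBot_div_const hb

theorem tendsto_kernelEst_atTop (hk : IsKernel k) (hb : 0 < b) (hn : 1 ≤ n) (x : ℕ → ℝ) :
    Tendsto (kernelEst k b n x) atTop (𝓝 1) := by
  refine tendsto_kernelEst hb hn x fun z => (tendsto_kernelDF_atTop hk).comp ?_
  exact (tendsto_atTop_add_const_right _ (-z) tendsto_id).atTop_div_const hb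

theorem aemeasurable_leftInv_kernelEst (hk : IsKernel k) (hb : 0 < b) (hn : 1 ≤ n) (x : ℕ → ℝ) :
    AEMeasurable (leftInv (kernelEst k b n x)) (volume.restrict (Ioo 0 1)) :=
  aemeasurable_leftInv (kernelEst_mono hk hb n x) (continuous_kernelEst hk hb n x)
    (tendsto_kernelEst_atBot hk hb hn x) (tendsto_kernelEst_atTop hk hb hn x)

theorem kernelEst_leftInv (hk : IsKernel k) (hb : 0 < b) (hn : 1 ≤ n) (x : ℕ → ℝ) {u : ℝ}
    (hu : u ∈ Ioo (0 : ℝ) 1) : kernelEst k b n x (leftInv (kernelEst k b n x) u) = u :=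
  apply_leftInv (kernelEst_mono hk hb n x) (continuous_kernelEst hk hb n x)
    (tendsto_kernelEst_atBot hk hb hn x) (tendsto_kernelEst_atTop hk hb hn x) hu

/-- The kernel density estimator. -/
def kernelDensity (k : ℝ → ℝ) (b : ℝ) (n : ℕ) (x : ℕ → ℝ) (t : ℝ) : ℝ :=
  1 / (n : ℝ) * ∑ i ∈ Finset.range n, scaledKernel k b (x i) t

theorem map_leftInv_kernelEst (hk : IsKernel k) (hb : 0 < b) (hn : 1 ≤ n) (x : ℕ → ℝ) :
    (volume.restrict (Ioo 0 1)).map (leftInv (kernelEst k b n x)) =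
      volume.withDensity fun t => ENNReal.ofReal (kernelDensity k b n x t) := by
  refine map_leftInv (fun t => ?_) (kernelEst_mono hk hb n x) (continuous_kernelEst hk hb n x)
    (tendsto_kernelEst_atBot hk hb hn x) (tendsto_kernelEst_atTop hk hb hn x)
  have hi : ∀ i, Integrable (scaledKernel k b (x i)) := fun i => integrable_scaledKernel hk hb _
  rw [withDensity_apply _ measurableSet_Iic, ← ofReal_integral_eq_lintegral_ofReal]
  · congr 1
    simp only [kernelDensity]
    rw [integral_const_mul, integral_finsetSum _ fun i _ => (hi i).integrableOn, kernelEst_eq k hb]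
    congr 1
    refine Finset.sum_congr rfl fun i _ => ?_
    simp only [scaledKernel]
    rw [integral_const_mul, setIntegral_Iic_scaled k hb]
    field_simp
  · exact ((integrable_finsetSum _ fun i _ => hi i).const_mul _).integrableOn
  · exact Eventually.of_forall fun t => mul_nonneg (by positivity)
      (Finset.sum_nonneg fun i _ => scaledKernel_nonneg hk hb _ _)

/-- The quantile function carries Lebesgue measure to the kernel density estimate, an average of
scaled kernels centred at the observations. -/
theorem lintegral_comp_leftInv_kernelEst (hk : IsKernel k) (hkm : Measurable k) (hb : 0 < b)
    (hn : 1 ≤ n) (x : ℕ → ℝ) {W : ℝ → ℝ} (hWm : Measurable W) (hW : Integrable W)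
    (hW0 : ∀ t, 0 ≤ W t) :
    ∫⁻ u in Ioo 0 1, ENNReal.ofReal (W (leftInv (kernelEst k b n x) u)) =
      ENNReal.ofReal (1 / (n : ℝ) * ∑ i ∈ Finset.range n, smoothing k W b (x i)) := by
  have hsm : ∀ i, Measurable (scaledKernel k b (x i)) := fun i =>
    (measurable_uncurry_scaledKernel hkm b).comp (measurable_const.prodMk measurable_id)
  have hdm : Measurable fun t => ENNReal.ofReal (kernelDensity k b n x t) := by
    unfold kernelDensity
    fun_prop
  rw [← lintegral_map' (f := fun t => ENNReal.ofReal (W t)) hWm.ennreal_ofReal.aemeasurable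
    (aemeasurable_leftInv_kernelEst hk hb hn x), map_leftInv_kernelEst hk hb hn x,
    lintegral_withDensity_eq_lintegral_mul _ hdm hWm.ennreal_ofReal,
    ENNReal.ofReal_mul (by positivity),
    ENNReal.ofReal_sum_of_nonneg fun i _ => smoothing_nonneg hk hb hW0 _]
  simp only [ofReal_smoothing hk hb hW hW0]
  have hpm : ∀ i ∈ Finset.range n, Measurable fun t =>
      ENNReal.ofReal (W t) * ENNReal.ofReal (scaledKernel k b (x i) t) := fun i _ =>
    hWm.ennreal_ofReal.mul (hsm i).ennreal_ofReal
  rw [← lintegral_finsetSum _ hpm,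
    ← lintegral_const_mul' _ _ ENNReal.ofReal_ne_top]
  refine lintegral_congr fun t => ?_
  simp only [Pi.mul_apply, kernelDensity]
  rw [ENNReal.ofReal_mul (by positivity),
    ENNReal.ofReal_sum_of_nonneg fun i _ => scaledKernel_nonneg hk hb _ _, mul_assoc,
    Finset.sum_mul]
  simp only [mul_comm]

theorem integrableOn_comp_leftInv_kernelEst (hk : IsKernel k) (hkm : Measurable k) (hb : 0 < b)
    (hn : 1 ≤ n) (x : ℕ → ℝ) {f : ℝ → ℝ} (hfm : Measurable f) (hf : Integrable f) :
    IntegrableOn (fun u => f (leftInv (kernelEst k b n x) u)) (Ioo 0 1) := by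
  refine ⟨(hfm.comp_aemeasurable
    (aemeasurable_leftInv_kernelEst hk hb hn x)).aestronglyMeasurable, ?_⟩
  have h := lintegral_comp_leftInv_kernelEst hk hkm hb hn x hfm.norm hf.norm fun _ => norm_nonneg _
  rw [hasFiniteIntegral_iff_norm, h]
  exact ENNReal.ofReal_lt_top

/-- Each observation below s contributes at least K((t-s)/b) to the sum. The case s = t gives the
factor K(0) used at the boundary; a fixed s < t gives a factor tending to 1, used for consistency.
-/
theorem kernelEst_ge (hk : IsKernel k) (hb : 0 < b) (n : ℕ) (x : ℕ → ℝ) (s t : ℝ) :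
    kernelDF k ((t - s) / b) * (countLT n x s / n) ≤ kernelEst k b n x t := by
  rw [kernelEst_eq k hb, ← sum_indicator_Iio, ← mul_div_assoc, Finset.mul_sum, div_eq_inv_mul,
    one_div]
  gcongr with i hi
  simp only [indicator_apply, mem_Iio]
  split_ifs with h
  · rw [mul_one]
    exact kernelDF_mono hk (by gcongr)
  · rw [mul_zero]
    exact kernelDF_nonneg hk _

/-- The mirror image: the reflected sample counts the observations above s. -/
theorem one_sub_kernelEst_ge (hk : IsKernel k) (hb : 0 < b) (hn : 1 ≤ n) (x : ℕ → ℝ) (s t : ℝ) :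
    (1 - kernelDF k ((t - s) / b)) * (countLT n (fun i => 1 - x i) (1 - s) / n) ≤
      1 - kernelEst k b n x t := by
  have hn0 : (n : ℝ) ≠ 0 := by exact_mod_cast (by omega : n ≠ 0)
  have h1 : 1 - kernelEst k b n x t =
      (n : ℝ)⁻¹ * ∑ i ∈ Finset.range n, (1 - kernelDF k ((t - x i) / b)) := by
    rw [kernelEst_eq k hb, Finset.sum_sub_distrib]
    simp only [Finset.sum_const, Finset.card_range, nsmul_eq_mul]
    field_simp
  rw [h1, ← sum_indicator_Iio, ← mul_div_assoc, Finset.mul_sum, div_eq_inv_mul]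
  gcongr with i hi
  simp only [indicator_apply, mem_Iio, sub_lt_sub_iff_left]
  split_ifs with h
  · rw [mul_one]
    gcongr
    exact kernelDF_mono hk (by gcongr)
  · rw [mul_zero, sub_nonneg]
    exact kernelDF_le_one hk _

/-- For a < u a rational q is placed between them. The proportion of observations above q tends to 1
- q > 1 - u, and almost all their kernel mass lies to the right of a, so the estimator at a is
eventually below u; symmetrically for a > u. -/
theorem tendsto_leftInv_kernelEst (hk : IsKernel k) {b : ℕ → ℝ} (hb : IsBandwidth b) {x : ℕ → ℝ}
    (hl : ∀ q : ℚ, (q : ℝ) ∈ Ioo (0 : ℝ) 1 →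
      Tendsto (fun n : ℕ => (countLT n x q : ℝ) / n) atTop (𝓝 q))
    (hr : ∀ q : ℚ, (q : ℝ) ∈ Ioo (0 : ℝ) 1 →
      Tendsto (fun n : ℕ => (countLT n (fun i => 1 - x i) q : ℝ) / n) atTop (𝓝 q))
    {u : ℝ} (hu : u ∈ Ioo (0 : ℝ) 1) :
    Tendsto (fun n => leftInv (kernelEst k (b n) n x) u) atTop (𝓝 u) := by
  have hb0 : Tendsto (fun n => (b n)⁻¹) atTop atTop := by
    refine tendsto_inv_nhdsGT_zero.comp (tendsto_nhdsWithin_iff.2 ⟨hb.tendsto_zero, ?_⟩)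
    filter_upwards [eventually_ge_atTop 1] with n hn using hb.pos n hn
  have hlow : ∀ a < u, ∀ᶠ n in atTop, kernelEst k (b n) n x a < u := by
    intro a ha
    obtain ⟨q, hq1, hq2⟩ := exists_rat_btwn (max_lt ha hu.1)
    have hq : ((1 - q : ℚ) : ℝ) ∈ Ioo (0 : ℝ) 1 := by
      push_cast
      exact ⟨by linarith [hu.2], by linarith [(le_max_right a 0).trans_lt hq1]⟩
    have h1 : Tendsto (fun n => kernelDF k ((a - q) / b n)) atTop (𝓝 0) := by
      refine (tendsto_kernelDF_atBot hk).comp ?_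
      simp only [div_eq_mul_inv]
      exact hb0.const_mul_atTop_of_neg (by linarith [(le_max_left a 0).trans_lt hq1])
    have h2 := ((tendsto_const_nhds (x := (1 : ℝ))).sub h1).mul (hr (1 - q) hq)
    push_cast at h2
    filter_upwards [h2.eventually_const_lt (show 1 - u < (1 - 0) * (1 - (q : ℝ)) by linarith),
      eventually_ge_atTop 1] with n hn hn1
    have := one_sub_kernelEst_ge hk (hb.pos n hn1) hn1 x q a
    linarith
  have hupp : ∀ a > u, ∀ᶠ n in atTop, u ≤ kernelEst k (b n) n x a := by
    intro a ha
    obtain ⟨q, hq1, hq2⟩ := exists_rat_btwn (lt_min ha hu.2)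
    have hq : (q : ℝ) ∈ Ioo (0 : ℝ) 1 := ⟨hu.1.trans hq1, hq2.trans_le (min_le_right _ _)⟩
    have h1 : Tendsto (fun n => kernelDF k ((a - q) / b n)) atTop (𝓝 1) := by
      refine (tendsto_kernelDF_atTop hk).comp ?_
      simp only [div_eq_mul_inv]
      exact hb0.const_mul_atTop (by linarith [hq2.trans_le (min_le_left a 1)])
    have h2 := h1.mul (hl q hq)
    filter_upwards [h2.eventually_const_lt (show u < 1 * (q : ℝ) by linarith),
      eventually_ge_atTop 1] with n hn hn1
    exact hn.le.trans (kernelEst_ge hk (hb.pos n hn1) n x q a)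
  rw [tendsto_order]
  constructor
  · intro a ha
    obtain ⟨a', h1, h2⟩ := exists_between ha
    -- The point u + 1 only shows that the set defining the quantile is nonempty; below, u - 1 only
    -- shows that it is bounded below.
    filter_upwards [hlow a' h2, hupp (u + 1) (by linarith), eventually_ge_atTop 1] with n h3 h4 hn
    exact h1.trans_le (le_leftInv (kernelEst_mono hk (hb.pos n hn) n x) h3 h4)
  · intro a ha
    obtain ⟨a', h1, h2⟩ := exists_between ha
    filter_upwards [hupp a' h1, hlow (u - 1) (by linarith), eventually_ge_atTop 1] with n h3 h4 hn
    exact (leftInv_le (kernelEst_mono hk (hb.pos n hn) n x) h4 h3).trans_lt h2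

end Estimator

/-! ### The empirical quantile function -/

section Empirical

/-- The empirical quantile function of `x 0, …, x (n-1)`. -/
def empQuantile (n : ℕ) (x : ℕ → ℝ) (u : ℝ) : ℝ :=
  if h : ⌈(n : ℝ) * u⌉₊ - 1 < n then orderStat n x ⟨⌈(n : ℝ) * u⌉₊ - 1, h⟩ else 0

/-- On (0,1) the rank ⌈nu⌉ is one of 1, …, n, so neither the truncated subtraction nor the default
value in `empQuantile` plays a role. -/
theorem ceil_bounds {n : ℕ} (hn : 1 ≤ n) {u : ℝ} (hu : u ∈ Ioo (0 : ℝ) 1) :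
    1 ≤ ⌈(n : ℝ) * u⌉₊ ∧ ⌈(n : ℝ) * u⌉₊ ≤ n := by
  have hn0 : (0 : ℝ) < n := by exact_mod_cast hn
  refine ⟨Nat.one_le_ceil_iff.2 (mul_pos hn0 hu.1), Nat.ceil_le.2 ?_⟩
  nlinarith [hu.2]

/-- Observations strictly below an order statistic occupy earlier sorted positions; with ties this
is only an inequality. -/
theorem countLT_orderStat_le (n : ℕ) (x : ℕ → ℝ) (i : Fin n) :
    countLT n x (orderStat n x i) ≤ i := by
  have hmono := Tuple.monotone_sort fun j : Fin n => x j
  set σ := Tuple.sort fun j : Fin n => x j with hσ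
  have h : (Finset.range n).filter (fun j => x j < orderStat n x i) ⊆
      (Finset.Iio i).image fun j : Fin n => ((σ j : Fin n) : ℕ) := by
    intro j hj
    obtain ⟨hj1, hj2⟩ := Finset.mem_filter.1 hj
    refine Finset.mem_image.2 ⟨σ.symm ⟨j, Finset.mem_range.1 hj1⟩, Finset.mem_Iio.2 ?_, by simp⟩
    by_contra! hle
    have := hmono hle
    simp only [Function.comp, Equiv.apply_symm_apply] at this
    exact absurd hj2 (not_lt.2 this)
  calc countLT n x (orderStat n x i) ≤ _ := Finset.card_le_card h
    _ ≤ (Finset.Iio i).card := Finset.card_image_le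
    _ = i := by simp

theorem countLT_one_sub_orderStat_le (n : ℕ) (x : ℕ → ℝ) (i : Fin n) :
    countLT n (fun j => 1 - x j) (1 - orderStat n x i) ≤ n - 1 - i := by
  have hmono := Tuple.monotone_sort fun j : Fin n => x j
  set σ := Tuple.sort fun j : Fin n => x j with hσ
  have h : (Finset.range n).filter (fun j => 1 - x j < 1 - orderStat n x i) ⊆
      (Finset.Ioi i).image fun j : Fin n => ((σ j : Fin n) : ℕ) := by
    intro j hj
    obtain ⟨hj1, hj2⟩ := Finset.mem_filter.1 hj
    refine Finset.mem_image.2 ⟨σ.symm ⟨j, Finset.mem_range.1 hj1⟩, Finset.mem_Ioi.2 ?_, by simp⟩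
    by_contra! hle
    have := hmono hle
    simp only [Function.comp, Equiv.apply_symm_apply] at this
    have h3 : x j ≤ orderStat n x i := this
    linarith
  calc countLT n (fun j => 1 - x j) (1 - orderStat n x i) ≤ _ := Finset.card_le_card h
    _ ≤ (Finset.Ioi i).card := Finset.card_image_le
    _ = n - 1 - i := by simp

theorem countLT_empQuantile {n : ℕ} (hn : 1 ≤ n) (x : ℕ → ℝ) {u : ℝ} (hu : u ∈ Ioo (0 : ℝ) 1) :
    countLT n x (empQuantile n x u) + 1 ≤ ⌈(n : ℝ) * u⌉₊ ∧
      countLT n (fun j => 1 - x j) (1 - empQuantile n x u) + ⌈(n : ℝ) * u⌉₊ ≤ n := by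
  obtain ⟨h1, h2⟩ := ceil_bounds hn hu
  have h : ⌈(n : ℝ) * u⌉₊ - 1 < n := by omega
  have h3 := countLT_orderStat_le n x ⟨_, h⟩
  have h4 := countLT_one_sub_orderStat_le n x ⟨_, h⟩
  simp only [empQuantile, dif_pos h]
  simp only at h3 h4
  omega

/-- If the quantile were at most a < q < u, at most n - ⌈nu⌉ observations would exceed q, although
their proportion tends to 1 - q > 1 - u. The other side is similar. -/
theorem tendsto_empQuantile {x : ℕ → ℝ}
    (hl : ∀ q : ℚ, (q : ℝ) ∈ Ioo (0 : ℝ) 1 →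
      Tendsto (fun n : ℕ => (countLT n x q : ℝ) / n) atTop (𝓝 q))
    (hr : ∀ q : ℚ, (q : ℝ) ∈ Ioo (0 : ℝ) 1 →
      Tendsto (fun n : ℕ => (countLT n (fun i => 1 - x i) q : ℝ) / n) atTop (𝓝 q))
    {u : ℝ} (hu : u ∈ Ioo (0 : ℝ) 1) :
    Tendsto (fun n => empQuantile n x u) atTop (𝓝 u) := by
  rw [tendsto_order]
  constructor
  · intro a ha
    obtain ⟨q, hq1, hq2⟩ := exists_rat_btwn (max_lt ha hu.1)
    have hq : ((1 - q : ℚ) : ℝ) ∈ Ioo (0 : ℝ) 1 := by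
      push_cast
      exact ⟨by linarith [hu.2], by linarith [(le_max_right a 0).trans_lt hq1]⟩
    have h2 := hr (1 - q) hq
    push_cast at h2
    filter_upwards [h2.eventually_const_lt (show 1 - u < 1 - (q : ℝ) by linarith),
      eventually_ge_atTop 1] with n h3 hn
    by_contra! hle
    have hn0 : (0 : ℝ) < n := by exact_mod_cast hn
    have h4 : countLT n (fun i => 1 - x i) (1 - q) ≤
        countLT n (fun i => 1 - x i) (1 - empQuantile n x u) :=
      countLT_mono _ _ (by linarith [(le_max_left a 0).trans_lt hq1])
    have h5 := (countLT_empQuantile hn x hu).2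
    have h6 : (countLT n (fun i => 1 - x i) (1 - q) : ℝ) + ⌈(n : ℝ) * u⌉₊ ≤ n := by
      rw [← Nat.cast_add]
      exact Nat.cast_le.2 (by omega)
    have h7 := Nat.le_ceil ((n : ℝ) * u)
    rw [lt_div_iff₀ hn0] at h3
    linarith
  · intro a ha
    obtain ⟨q, hq1, hq2⟩ := exists_rat_btwn (lt_min ha hu.2)
    have hq : (q : ℝ) ∈ Ioo (0 : ℝ) 1 := ⟨hu.1.trans hq1, hq2.trans_le (min_le_right _ _)⟩
    filter_upwards [(hl q hq).eventually_const_lt hq1, eventually_ge_atTop 1] with n h3 hn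
    by_contra! hle
    have hn0 : (0 : ℝ) < n := by exact_mod_cast hn
    have h4 : countLT n x q ≤ countLT n x (empQuantile n x u) :=
      countLT_mono _ _ (by linarith [hq2.trans_le (min_le_left a 1)])
    have h5 := (countLT_empQuantile hn x hu).1
    have h6 : (countLT n x q : ℝ) + 1 ≤ ⌈(n : ℝ) * u⌉₊ := by
      exact_mod_cast (by omega)
    have h7 := Nat.ceil_lt_add_one (mul_nonneg hn0.le hu.1.le)
    rw [lt_div_iff₀ hn0] at h3
    linarith

theorem measurable_natCeil_comp (n : ℕ) (F : ℕ → ℝ) :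
    Measurable fun u : ℝ => F ⌈(n : ℝ) * u⌉₊ :=
  (measurable_from_nat (f := F)).comp
    (Nat.measurable_ceil.comp (measurable_const.mul measurable_id))

theorem exists_bound_natCeil (n : ℕ) (F : ℕ → ℝ) :
    ∃ C, ∀ u ∈ Ioo (0 : ℝ) 1, |F ⌈(n : ℝ) * u⌉₊| ≤ C := by
  refine ⟨∑ i ∈ Finset.range (n + 1), |F i|, fun u hu => ?_⟩
  refine Finset.single_le_sum (f := fun i => |F i|) (fun i _ => abs_nonneg _)
    (Finset.mem_range.2 (Nat.lt_succ_iff.2 (Nat.ceil_le.2 ?_)))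
  nlinarith [hu.2, (Nat.cast_nonneg n : (0 : ℝ) ≤ n)]

theorem integrableOn_natCeil (n : ℕ) (F : ℕ → ℝ) :
    IntegrableOn (fun u : ℝ => F ⌈(n : ℝ) * u⌉₊) (Ioo 0 1) := by
  obtain ⟨C, hC⟩ := exists_bound_natCeil n F
  refine Integrable.of_bound (measurable_natCeil_comp n F).aestronglyMeasurable C ?_
  exact (ae_restrict_iff' measurableSet_Ioo).2 (Eventually.of_forall fun u hu => hC u hu)

theorem integral_natCeil {n : ℕ} (hn : 1 ≤ n) (F : ℕ → ℝ) :
    ∫ u in Ioo (0 : ℝ) 1, F ⌈(n : ℝ) * u⌉₊ = 1 / (n : ℝ) * ∑ i ∈ Finset.range n, F (i + 1) := by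
  have hn0 : (0 : ℝ) < n := by exact_mod_cast hn
  have hval : ∀ i : ℕ, ∀ u ∈ Ioc ((i : ℝ) / n) (((i + 1 : ℕ) : ℝ) / n), ⌈(n : ℝ) * u⌉₊ = i + 1 := by
    intro i u hu
    rw [Nat.ceil_eq_iff (by omega)]
    obtain ⟨h1, h2⟩ := hu
    rw [div_lt_iff₀ hn0] at h1
    rw [le_div_iff₀ hn0] at h2
    exact ⟨by simpa [mul_comm] using h1, by linarith⟩
  have hle : ∀ i : ℕ, (i : ℝ) / n ≤ ((i + 1 : ℕ) : ℝ) / n := fun i => by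
    gcongr
    exact i.le_succ
  have hint : ∀ i < n, IntervalIntegrable (fun u : ℝ => F ⌈(n : ℝ) * u⌉₊) volume
      ((i : ℝ) / n) (((i + 1 : ℕ) : ℝ) / n) := by
    intro i _
    rw [intervalIntegrable_iff_integrableOn_Ioc_of_le (hle i)]
    exact (integrableOn_const (by simp) (by simp)).congr_fun
      (f := fun _ => F (i + 1)) (fun u hu => by simp only [hval i u hu]) measurableSet_Ioc
  have h := intervalIntegral.sum_integral_adjacent_intervals
    (a := fun i : ℕ => (i : ℝ) / n) hint
  simp only [Nat.cast_zero, zero_div, div_self hn0.ne'] at h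
  rw [← integral_Ioc_eq_integral_Ioo, ← intervalIntegral.integral_of_le zero_le_one, ← h,
    Finset.mul_sum]
  refine Finset.sum_congr rfl fun i _ => ?_
  rw [intervalIntegral.integral_of_le (hle i),
    setIntegral_congr_fun (g := fun _ => F (i + 1)) measurableSet_Ioc
      (fun u hu => by simp only [hval i u hu]), setIntegral_const, smul_eq_mul]
  congr 1
  rw [Real.volume_real_Ioc_of_le (hle i)]
  push_cast
  field_simp
  ring

end Empirical

/-! ### Boundary weights -/

/-- The weight `(t(1-t))^{-s}` on `(0,1)`, extended by zero. -/
def weight (s t : ℝ) : ℝ := (Ioo (0 : ℝ) 1).indicator (fun t => t ^ (-s) * (1 - t) ^ (-s)) t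

theorem weight_nonneg (s t : ℝ) : 0 ≤ weight s t := by
  refine indicator_nonneg (fun t ht => ?_) t
  have := ht.1
  have := sub_pos.2 ht.2
  positivity

theorem weight_of_mem {s t : ℝ} (ht : t ∈ Ioo (0 : ℝ) 1) :
    weight s t = t ^ (-s) * (1 - t) ^ (-s) := indicator_of_mem ht _

theorem measurable_weight (s : ℝ) : Measurable (weight s) := by
  have : Measurable fun t : ℝ => t ^ (-s) * (1 - t) ^ (-s) := by fun_prop
  exact this.indicator measurableSet_Ioo

theorem integrable_weight {s : ℝ} (hs : s < 1) : Integrable (weight s) :=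
  (integrable_indicator_iff measurableSet_Ioo).2
    (integrableOn_rpow_mul_one_sub_rpow (by linarith) (by linarith))

theorem weight_rpow (s t : ℝ) {p : ℝ} (hp : p ≠ 0) : weight s t ^ p = weight (s * p) t := by
  by_cases ht : t ∈ Ioo (0 : ℝ) 1
  · have h0 := ht.1.le
    have h1 := (sub_pos.2 ht.2).le
    rw [weight_of_mem ht, weight_of_mem ht,
      Real.mul_rpow (Real.rpow_nonneg h0 _) (Real.rpow_nonneg h1 _), ← Real.rpow_mul h0,
      ← Real.rpow_mul h1, neg_mul]
  · simp only [weight, indicator_of_notMem ht]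
    exact Real.zero_rpow hp

theorem rpow_mul_rpow_le_weight {s p q t : ℝ} (ht : t ∈ Ioo (0 : ℝ) 1) (hp : -s ≤ p)
    (hq : -s ≤ q) : t ^ p * (1 - t) ^ q ≤ weight s t := by
  rw [weight_of_mem ht]
  have h1 := sub_pos.2 ht.2
  have h0 := ht.1
  gcongr ?_ * ?_
  · exact Real.rpow_le_rpow_of_exponent_ge h0 ht.2.le hp
  · exact Real.rpow_le_rpow_of_exponent_ge h1 (by linarith) hq

/-! ### The function `g` -/

/-- On (0,1) the function is a difference of two monotone functions. -/
theorem IsClassG.measurable_indicator {g : ℝ → ℝ} (hg : IsClassG g) :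
    Measurable ((Ioo (0 : ℝ) 1).indicator g) := by
  obtain ⟨p, q, hp, hq, h⟩ := hg.locallyBV.exists_monotoneOn_sub_monotoneOn
  have hsub : Measurable fun t : Ioo (0 : ℝ) 1 => g t := by
    have hp' : Monotone fun t : Ioo (0 : ℝ) 1 => p t := fun s t hst => hp s.2 t.2 hst
    have hq' : Monotone fun t : Ioo (0 : ℝ) 1 => q t := fun s t hst => hq s.2 t.2 hst
    simp only [h]
    exact hp'.measurable.sub hq'.measurable
  refine measurable_of_restrict_of_restrict_compl (s := Ioo (0 : ℝ) 1) measurableSet_Ioo ?_ ?_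
  · have e : (Ioo (0 : ℝ) 1).domRestrict ((Ioo (0 : ℝ) 1).indicator g) =
        fun t : Ioo (0 : ℝ) 1 => g t :=
      funext fun t => indicator_of_mem t.2 g
    rwa [e]
  · have e : (Ioo (0 : ℝ) 1)ᶜ.domRestrict ((Ioo (0 : ℝ) 1).indicator g) = fun _ => 0 :=
      funext fun t => indicator_of_notMem t.2 g
    rw [e]
    exact measurable_const

/-- Functions of locally bounded variation are differentiable almost everywhere; continuity is all
that the limit argument takes from this. -/
theorem IsClassG.ae_continuousAt_indicator {g : ℝ → ℝ} (hg : IsClassG g) :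
    ∀ᵐ u ∂(volume.restrict (Ioo (0 : ℝ) 1)), ContinuousAt ((Ioo (0 : ℝ) 1).indicator g) u := by
  rw [ae_restrict_iff' measurableSet_Ioo]
  filter_upwards [hg.locallyBV.ae_differentiableWithinAt_of_mem] with u hu hmem
  have hnhds := isOpen_Ioo.mem_nhds hmem
  have h1 : ContinuousAt g u := (hu hmem).continuousWithinAt.continuousAt hnhds
  refine h1.congr ?_
  filter_upwards [hnhds] with v hv
  exact (indicator_of_mem hv g).symm

/-! ### Scores -/

theorem score_of_pos (c : ℕ → ℕ → ℝ) {n : ℕ} (hn : 1 ≤ n) {u : ℝ} (hu : u ∈ Ioo (0 : ℝ) 1) :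
    score c n u = c n ⌈(n : ℝ) * u⌉₊ := by
  rw [score, max_eq_right (ceil_bounds hn hu).1]

theorem measurable_score (c : ℕ → ℕ → ℝ) (n : ℕ) : Measurable (score c n) :=
  measurable_natCeil_comp n fun i => c n (max 1 i)

theorem exists_bound_score (c : ℕ → ℕ → ℝ) (n : ℕ) :
    ∃ C, ∀ u ∈ Ioo (0 : ℝ) 1, |score c n u| ≤ C :=
  exists_bound_natCeil n fun i => c n (max 1 i)

/-! ### Domination by boundary weights and the limit theorem for general quantile functions -/

section Bounded

variable {M b₁ b₂ δ : ℝ} {g : ℝ → ℝ} {hg : IsClassG g} {c : ℕ → ℕ → ℝ} {J : Ioo (0 : ℝ) 1 → ℝ}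

theorem IsBounded.integrable_indicator (h : IsBounded M b₁ b₂ δ g hg c J)
    (hb₁ : 0 < b₁) (hb₂ : 0 < b₂) (hδ : 0 < δ) : Integrable ((Ioo (0 : ℝ) 1).indicator g) := by
  have hD : IntegrableOn (fun t => M * (t ^ (-1 + b₁ + δ) * (1 - t) ^ (-1 + b₂ + δ)))
      (Ioo (0 : ℝ) 1) :=
    (integrableOn_rpow_mul_one_sub_rpow (by linarith) (by linarith)).const_mul M
  refine Integrable.mono' ((integrable_indicator_iff measurableSet_Ioo).2 hD)
    hg.measurable_indicator.aestronglyMeasurable (Eventually.of_forall fun t => ?_)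
  by_cases ht : t ∈ Ioo (0 : ℝ) 1
  · rw [indicator_of_mem ht, indicator_of_mem ht, ← mul_assoc]
    exact h.g_le t ht
  · simp [indicator_of_notMem ht]

/-- The powers b₁ and b₂ cancel in the product D B, leaving [u(1-u)]^(-1+δ). -/
theorem IsBounded.abs_mul_score_le (h : IsBounded M b₁ b₂ δ g hg c J) (hM : 0 < M) {s : ℝ}
    (hs : 1 - δ ≤ s) {n : ℕ} (hn : 1 ≤ n) {u : ℝ} (hu : u ∈ Ioo (0 : ℝ) 1) :
    |g u * score c n u| ≤ M ^ 2 * weight s u := by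
  have h0 := hu.1
  have h1 := sub_pos.2 hu.2
  rw [abs_mul]
  calc |g u| * |score c n u| ≤ boundD M b₁ b₂ δ u * boundB M b₁ b₂ u := by
        refine mul_le_mul (h.g_le u hu) (h.score_le n hn u hu) (abs_nonneg _) ?_
        exact (abs_nonneg _).trans (h.g_le u hu)
    _ = M ^ 2 * (u ^ (-1 + δ) * (1 - u) ^ (-1 + δ)) := by
        have e1 : u ^ (-1 + δ) = u ^ (-1 + b₁ + δ) * u ^ (-b₁) := by
          rw [← Real.rpow_add h0]
          ring_nf
        have e2 : (1 - u) ^ (-1 + δ) = (1 - u) ^ (-1 + b₂ + δ) * (1 - u) ^ (-b₂) := by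
          rw [← Real.rpow_add h1]
          ring_nf
        rw [boundD, boundB, e1, e2]
        ring
    _ ≤ M ^ 2 * weight s u := by
        gcongr
        exact rpow_mul_rpow_le_weight hu (by linarith) (by linarith)

theorem IsBounded.integrableOn_mul_score (h : IsBounded M b₁ b₂ δ g hg c J) (hM : 0 < M)
    (hδ : 0 < δ) {n : ℕ} (hn : 1 ≤ n) :
    IntegrableOn (fun t => g t * score c n t) (Ioo 0 1) := by
  have hm : AEStronglyMeasurable (fun t => g t * score c n t) (volume.restrict (Ioo 0 1)) := by
    refine ((hg.measurable_indicator.mul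
      (measurable_score c n)).aestronglyMeasurable.congr ?_)
    refine (ae_restrict_iff' measurableSet_Ioo).2 (Eventually.of_forall fun t ht => ?_)
    simp only [Pi.mul_apply, indicator_of_mem ht]
  refine Integrable.mono' (((integrable_weight (s := 1 - δ) (by linarith)).const_mul
    (M ^ 2)).integrableOn) hm ?_
  exact (ae_restrict_iff' measurableSet_Ioo).2
    (Eventually.of_forall fun t ht => h.abs_mul_score_le hM le_rfl hn ht)

theorem IsBounded.abs_coeff_le (h : IsBounded M b₁ b₂ δ g hg c J) (hM : 0 < M) (hb₁ : 0 < b₁)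
    (hb₂ : 0 < b₂) {n i : ℕ} (hi : 1 ≤ i) (hin : i ≤ n) :
    |c n i| ≤ M * ((i : ℝ) / n / 2) ^ (-b₁) * (((n : ℝ) - i + 1) / n / 2) ^ (-b₂) := by
  have hn0 : (0 : ℝ) < n := by exact_mod_cast hi.trans hin
  have hi' : (1 : ℝ) ≤ i := by exact_mod_cast hi
  have hin' : (i : ℝ) ≤ n := by exact_mod_cast hin
  -- The score equals c_{ni} on a whole cell. Its midpoint lies in (0,1) even for i = n and
  -- satisfies both t ≥ i/(2n) and 1 - t ≥ (n-i+1)/(2n).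
  set t : ℝ := ((i : ℝ) - 1 / 2) / n with ht
  have hnt : (n : ℝ) * t = i - 1 / 2 := by
    rw [ht]
    field_simp
  have h1t : 1 - t = ((n : ℝ) - i + 1 / 2) / n := by
    rw [ht]
    field_simp
    ring
  have hmem : t ∈ Ioo (0 : ℝ) 1 := by
    constructor
    · rw [ht]
      apply div_pos _ hn0
      linarith
    · rw [ht, div_lt_one hn0]
      linarith
  have hceil : ⌈(n : ℝ) * t⌉₊ = i := by
    rw [hnt, Nat.ceil_eq_iff (by omega), Nat.cast_sub hi]
    push_cast
    constructor <;> linarith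
  have hle := h.score_le n (hi.trans hin) t hmem
  rw [score_of_pos c (hi.trans hin) hmem, hceil, boundB] at hle
  refine hle.trans ?_
  have hpos : 0 < ((n : ℝ) - i + 1) / n / 2 := by
    have : 0 < (n : ℝ) - i + 1 := by linarith
    positivity
  have hpos' : 0 < (i : ℝ) / n / 2 := by positivity
  have e1 : t ^ (-b₁) ≤ ((i : ℝ) / n / 2) ^ (-b₁) := by
    refine Real.rpow_le_rpow_of_nonpos hpos' ?_ (by linarith)
    rw [ht, div_right_comm]
    gcongr
    linarith
  have e2 : (1 - t) ^ (-b₂) ≤ (((n : ℝ) - i + 1) / n / 2) ^ (-b₂) := by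
    refine Real.rpow_le_rpow_of_nonpos hpos ?_ (by linarith)
    rw [h1t, div_right_comm]
    gcongr
    linarith
  have h1t0 := sub_pos.2 hmem.2
  gcongr

theorem rpow_neg_le_of_rpow_le {a t C β e : ℝ} (ht : 0 < t) (hC : 0 < C) (hβ : 0 < β)
    (h : t ^ e ≤ C * a) : (a / 2) ^ (-β) ≤ (2 * C) ^ β * t ^ (-(β * e)) := by
  have hte : 0 < t ^ e := Real.rpow_pos_of_pos ht e
  have h1 : t ^ e / (2 * C) ≤ a / 2 := by
    rw [div_le_iff₀ (by positivity)]
    linarith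
  calc (a / 2) ^ (-β) ≤ (t ^ e / (2 * C)) ^ (-β) :=
        Real.rpow_le_rpow_of_nonpos (by positivity) h1 (by linarith)
    _ = (2 * C) ^ β * t ^ (-(β * e)) := by
        rw [Real.div_rpow hte.le (by positivity), ← Real.rpow_mul ht.le,
          Real.rpow_neg (by positivity : 0 ≤ 2 * C), div_inv_eq_mul, mul_comm]
        ring_nf

/-- Here g is evaluated at t and the score at u. The boundary hypothesis turns the bound on the
coefficient into powers of t and 1 - t with exponents -b_i(1+η); multiplied by D they leave -1 + δ -
b_i η, which is at least -s. -/
theorem IsBounded.abs_indicator_mul_score_le (h : IsBounded M b₁ b₂ δ g hg c J) (hM : 0 < M)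
    (hb₁ : 0 < b₁) (hb₂ : 0 < b₂) {η s C : ℝ} (hC : 0 < C) (hs₁ : 1 - δ + b₁ * η ≤ s)
    (hs₂ : 1 - δ + b₂ * η ≤ s) {n : ℕ} (hn : 1 ≤ n) {u t : ℝ} (hu : u ∈ Ioo (0 : ℝ) 1)
    (ht : t ∈ Ioo (0 : ℝ) 1 → t ^ (1 + η) ≤ C * (⌈(n : ℝ) * u⌉₊ / n) ∧
      (1 - t) ^ (1 + η) ≤ C * ((n - ⌈(n : ℝ) * u⌉₊ + 1) / n)) :
    |(Ioo (0 : ℝ) 1).indicator g t * score c n u| ≤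
      M ^ 2 * ((2 * C) ^ b₁ * (2 * C) ^ b₂) * weight s t := by
  by_cases hmem : t ∈ Ioo (0 : ℝ) 1
  · obtain ⟨h1, h2⟩ := ht hmem
    obtain ⟨hc1, hc2⟩ := ceil_bounds hn hu
    have ht0 := hmem.1
    have ht1 := sub_pos.2 hmem.2
    rw [indicator_of_mem hmem, abs_mul, score_of_pos c hn hu]
    calc |g t| * |c n ⌈(n : ℝ) * u⌉₊|
        ≤ (M * t ^ (-1 + b₁ + δ) * (1 - t) ^ (-1 + b₂ + δ)) *
          (M * ((2 * C) ^ b₁ * t ^ (-(b₁ * (1 + η)))) *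
            ((2 * C) ^ b₂ * (1 - t) ^ (-(b₂ * (1 + η))))) := by
          have hc := h.abs_coeff_le hM hb₁ hb₂ hc1 hc2
          have hpos : 0 ≤ ((n : ℝ) - ⌈(n : ℝ) * u⌉₊ + 1) / n / 2 := by
            have : (⌈(n : ℝ) * u⌉₊ : ℝ) ≤ n := by exact_mod_cast hc2
            have : 0 ≤ (n : ℝ) - ⌈(n : ℝ) * u⌉₊ + 1 := by linarith
            positivity
          refine mul_le_mul (h.g_le t hmem) (hc.trans ?_) (abs_nonneg _) (by positivity)
          gcongr
          · exact rpow_neg_le_of_rpow_le ht0 hC hb₁ h1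
          · exact rpow_neg_le_of_rpow_le ht1 hC hb₂ h2
      _ = M ^ 2 * ((2 * C) ^ b₁ * (2 * C) ^ b₂) *
          (t ^ (-1 + δ - b₁ * η) * (1 - t) ^ (-1 + δ - b₂ * η)) := by
          have e1 : t ^ (-1 + δ - b₁ * η) = t ^ (-1 + b₁ + δ) * t ^ (-(b₁ * (1 + η))) := by
            rw [← Real.rpow_add ht0]
            ring_nf
          have e2 : (1 - t) ^ (-1 + δ - b₂ * η) =
              (1 - t) ^ (-1 + b₂ + δ) * (1 - t) ^ (-(b₂ * (1 + η))) := by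
            rw [← Real.rpow_add ht1]
            ring_nf
          rw [e1, e2]
          ring
      _ ≤ M ^ 2 * ((2 * C) ^ b₁ * (2 * C) ^ b₂) * weight s t := by
          gcongr
          exact rpow_mul_rpow_le_weight hmem (by linarith) (by linarith)
  · rw [indicator_of_notMem hmem, zero_mul, abs_zero]
    have := weight_nonneg s t
    positivity

/-- The score integrals of `g ∘ G_n` and `g` are asymptotically equal when the quantile functions
`G_n` tend to the identity, are controlled at the boundary, and the boundary weight remains bounded
along `G_n`. -/
theorem IsBounded.tendsto_integral_sub_centerMu (h : IsBounded M b₁ b₂ δ g hg c J) (hM : 0 < M)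
    (hb₁ : 0 < b₁) (hb₂ : 0 < b₂) (hδ : 0 < δ) {η s p C : ℝ} (hC : 0 < C) (hη : 0 < η)
    (hs₁ : 1 - δ + b₁ * η ≤ s) (hs₂ : 1 - δ + b₂ * η ≤ s) (hp : 1 < p) (hsp : s * p < 1)
    {G : ℕ → ℝ → ℝ} (hGm : ∀ n, 1 ≤ n → AEMeasurable (G n) (volume.restrict (Ioo 0 1)))
    (hG : ∀ u ∈ Ioo (0 : ℝ) 1, Tendsto (fun n => G n u) atTop (𝓝 u))
    (hbd : ∀ᶠ n : ℕ in atTop, ∀ u ∈ Ioo (0 : ℝ) 1, G n u ∈ Ioo (0 : ℝ) 1 →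
      G n u ^ (1 + η) ≤ C * (⌈(n : ℝ) * u⌉₊ / n) ∧
        (1 - G n u) ^ (1 + η) ≤ C * ((n - ⌈(n : ℝ) * u⌉₊ + 1) / n))
    {A : ℝ} (hA : ∀ᶠ n in atTop,
      ∫⁻ u in Ioo 0 1, ENNReal.ofReal (weight (s * p) (G n u)) ≤ ENNReal.ofReal A) :
    Tendsto (fun n => (∫ u in Ioo (0 : ℝ) 1, (Ioo (0 : ℝ) 1).indicator g (G n u) * score c n u) -
      centerMu g c n) atTop (𝓝 0) := by
  have hp0 : 0 < p := by linarith
  set gt := (Ioo (0 : ℝ) 1).indicator g with hgt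
  set C' := M ^ 2 * ((2 * C) ^ b₁ * (2 * C) ^ b₂) with hC'
  have hC'0 : 0 < C' := by positivity
  let f : ℕ → ℝ → ℝ := fun n u => gt (G n u) * score c n u - gt u * score c n u
  have hfm : ∀ n, 1 ≤ n → AEMeasurable (f n) (volume.restrict (Ioo 0 1)) := fun n hn =>
    ((hg.measurable_indicator.comp_aemeasurable (hGm n hn)).mul
      (measurable_score c n).aemeasurable).sub
      (hg.measurable_indicator.mul (measurable_score c n)).aemeasurable
  have hlim : ∀ᵐ u ∂(volume.restrict (Ioo (0 : ℝ) 1)),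
      Tendsto (fun n => f n u) atTop (𝓝 0) := by
    -- At a continuity point u of g the difference tends to 0, and the scores at u are bounded by
    -- B(u) uniformly in n.
    filter_upwards [hg.ae_continuousAt_indicator, ae_restrict_mem measurableSet_Ioo] with u hu hmem
    have h1 : Tendsto (fun n => |gt (G n u) - gt u| * boundB M b₁ b₂ u) atTop (𝓝 0) := by
      have := ((hu.tendsto.comp (hG u hmem)).sub_const (gt u)).abs.mul_const (boundB M b₁ b₂ u)
      rwa [sub_self, abs_zero, zero_mul] at this
    refine squeeze_zero_norm' ?_ h1
    filter_upwards [eventually_ge_atTop 1] with n hn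
    simp only [f, ← sub_mul]
    rw [norm_mul, Real.norm_eq_abs, Real.norm_eq_abs]
    gcongr
    exact h.score_le n hn u hmem
  have hpow : ∀ {z K w : ℝ}, 0 ≤ K → 0 ≤ w → |z| ≤ K * w →
      ‖z‖ₑ ^ p ≤ ENNReal.ofReal (K ^ p) * ENNReal.ofReal (w ^ p) := by
    intro z K w hK hw hz
    rw [← ENNReal.ofReal_mul (by positivity), ← Real.mul_rpow hK hw,
      Real.enorm_eq_ofReal_abs, ENNReal.ofReal_rpow_of_nonneg (abs_nonneg _) hp0.le]
    exact ENNReal.ofReal_le_ofReal (Real.rpow_le_rpow (abs_nonneg _) hz hp0.le)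
  have hW : ∫⁻ u in Ioo 0 1, ENNReal.ofReal (weight (s * p) u) ≠ ∞ := by
    rw [← ofReal_integral_eq_lintegral_ofReal (integrable_weight hsp).integrableOn
      (Eventually.of_forall (weight_nonneg _))]
    exact ENNReal.ofReal_ne_top
  have hbound : ∀ᶠ n in atTop, ∫⁻ u in Ioo 0 1, ‖f n u‖ₑ ^ p ≤
      2 ^ (p - 1) * (ENNReal.ofReal (C' ^ p) * ENNReal.ofReal A +
        ENNReal.ofReal ((M ^ 2) ^ p) * ∫⁻ u in Ioo 0 1, ENNReal.ofReal (weight (s * p) u)) := by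
    filter_upwards [hbd, hA, eventually_ge_atTop 1] with n h1 h2 hn
    have h2p : (2 : ℝ≥0∞) ^ (p - 1) ≠ ∞ := ENNReal.rpow_ne_top_of_nonneg (by linarith) (by simp)
    calc ∫⁻ u in Ioo 0 1, ‖f n u‖ₑ ^ p
        ≤ ∫⁻ u in Ioo 0 1, 2 ^ (p - 1) *
          (ENNReal.ofReal (C' ^ p) * ENNReal.ofReal (weight (s * p) (G n u)) +
            ENNReal.ofReal ((M ^ 2) ^ p) * ENNReal.ofReal (weight (s * p) u)) := by
          refine setLIntegral_mono' measurableSet_Ioo fun u hu => ?_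
          have e1 := hpow hC'0.le (weight_nonneg s _)
            (h.abs_indicator_mul_score_le hM hb₁ hb₂ hC hs₁ hs₂ hn hu (h1 u hu))
          have hs : 1 - δ ≤ s := by
            have := mul_pos hb₁ hη
            linarith
          have e2 := hpow (by positivity) (weight_nonneg s _) (h.abs_mul_score_le hM hs hn hu)
          rw [weight_rpow _ _ hp0.ne'] at e1 e2
          have e3 : gt u = g u := indicator_of_mem hu g
          calc ‖f n u‖ₑ ^ p ≤ (‖gt (G n u) * score c n u‖ₑ + ‖gt u * score c n u‖ₑ) ^ p := by
                gcongr
                exact enorm_sub_le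
            _ ≤ 2 ^ (p - 1) *
                (‖gt (G n u) * score c n u‖ₑ ^ p + ‖gt u * score c n u‖ₑ ^ p) :=
                ENNReal.rpow_add_le_mul_rpow_add_rpow _ _ hp.le
            _ ≤ _ := by
                rw [e3]
                gcongr
      _ = 2 ^ (p - 1) * (ENNReal.ofReal (C' ^ p) *
            (∫⁻ u in Ioo 0 1, ENNReal.ofReal (weight (s * p) (G n u))) +
          ENNReal.ofReal ((M ^ 2) ^ p) * ∫⁻ u in Ioo 0 1, ENNReal.ofReal (weight (s * p) u)) := by
          rw [lintegral_const_mul' _ _ h2p, lintegral_add_right,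
            lintegral_const_mul' _ _ ENNReal.ofReal_ne_top,
            lintegral_const_mul' _ _ ENNReal.ofReal_ne_top]
          exact (measurable_weight _).ennreal_ofReal.const_mul _
      _ ≤ _ := by gcongr
  have hL1 : Tendsto (fun n => ∫⁻ u in Ioo 0 1, ‖f n u‖ₑ) atTop (𝓝 0) := by
    -- The index is shifted because measurability of f n is only known for n ≥ 1.
    rw [← tendsto_add_atTop_iff_nat 1]
    refine tendsto_lintegral_enorm_of_rpow_bounded (f := fun n => f (n + 1))
      (fun n => hfm _ (by omega)) ?_ hp ?_ ((tendsto_add_atTop_nat 1).eventually hbound)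
    · filter_upwards [hlim] with u hu using hu.comp (tendsto_add_atTop_nat 1)
    · exact ENNReal.mul_ne_top (ENNReal.rpow_ne_top_of_nonneg (by linarith) (by simp))
        (ENNReal.add_ne_top.2 ⟨ENNReal.mul_ne_top ENNReal.ofReal_ne_top ENNReal.ofReal_ne_top,
          ENNReal.mul_ne_top ENNReal.ofReal_ne_top hW⟩)
  have hfi : ∀ᶠ n in atTop, IntegrableOn (f n) (Ioo 0 1) := by
    filter_upwards [hL1.eventually_lt_const ENNReal.zero_lt_top, eventually_ge_atTop 1] with n h1 hn
    exact ⟨(hfm n hn).aestronglyMeasurable, h1⟩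
  have hint := tendsto_integral_of_L1 (μ := volume.restrict (Ioo (0 : ℝ) 1)) (fun _ => (0 : ℝ))
    aestronglyMeasurable_const hfi (by simpa using hL1)
  rw [integral_zero] at hint
  refine hint.congr' ?_
  filter_upwards [hfi, eventually_ge_atTop 1] with n h1 hn
  have h2 : IntegrableOn (fun u => gt u * score c n u) (Ioo 0 1) :=
    (h.integrableOn_mul_score hM hδ hn).congr_fun
      (fun u hu => by simp only [hgt, indicator_of_mem hu]) measurableSet_Ioo
  -- Integrability along G_n is recovered from that of the difference.
  have h3 : IntegrableOn (fun u => gt (G n u) * score c n u) (Ioo 0 1) :=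
    (h1.add h2).congr (Eventually.of_forall fun u => by simp [f])
  simp only [f]
  rw [integral_sub h3 h2, centerMu]
  congr 1
  exact setIntegral_congr_fun measurableSet_Ioo fun u hu => by simp only [hgt, indicator_of_mem hu]

end Bounded

/-! ### The two statistics along a fixed sample path -/

section Path

variable {x : ℕ → ℝ} {η C₀ : ℝ}

/-- Control of the kernel quantile function at the boundary. -/
theorem leftInv_kernelEst_boundary {k : ℝ → ℝ} (hk : IsKernel k) {b : ℕ → ℝ} (hb : IsBandwidth b)
    (hC₀ : 0 < C₀)
    (hl : ∀ᶠ n : ℕ in atTop, ∀ t ∈ Ioo (0 : ℝ) 1,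
      t ^ (1 + η) ≤ C₀ * (((countLT n x t : ℝ) + 1) / n))
    (hr : ∀ᶠ n : ℕ in atTop, ∀ t ∈ Ioo (0 : ℝ) 1,
      t ^ (1 + η) ≤ C₀ * (((countLT n (fun i => 1 - x i) t : ℝ) + 1) / n)) :
    ∃ C > 0, ∀ᶠ n : ℕ in atTop, ∀ u ∈ Ioo (0 : ℝ) 1,
      leftInv (kernelEst k (b n) n x) u ∈ Ioo (0 : ℝ) 1 →
      leftInv (kernelEst k (b n) n x) u ^ (1 + η) ≤ C * (⌈(n : ℝ) * u⌉₊ / n) ∧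
        (1 - leftInv (kernelEst k (b n) n x) u) ^ (1 + η) ≤
          C * ((n - ⌈(n : ℝ) * u⌉₊ + 1) / n) := by
  have hK0 := kernelDF_zero_pos hk
  have hK1 := sub_pos.2 (kernelDF_zero_lt_one hk)
  set K := kernelDF k 0 with hK
  -- Here w is a count, m is u or 1 - u, and a is the corresponding rank from the left or the right;
  -- a ≥ 1 absorbs the summand 1.
  have key : ∀ {κ w a m N : ℝ}, 0 < κ → 0 < N → κ * (w / N) ≤ m → N * m ≤ a → 1 ≤ a →
      (w + 1) / N ≤ (κ⁻¹ + 1) * (a / N) := by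
    intro κ w a m N hκ hN h1 h2 h3
    have h4 : κ * w ≤ a := by
      have := mul_le_mul_of_nonneg_left h1 hN.le
      have e : N * (κ * (w / N)) = κ * w := by field_simp
      linarith
    have h5 : w ≤ κ⁻¹ * a := by
      rw [← div_eq_inv_mul, le_div_iff₀ hκ]
      linarith
    rw [mul_div_assoc']
    gcongr
    linarith
  refine ⟨C₀ * (K⁻¹ + 1 + ((1 - K)⁻¹ + 1)), by positivity, ?_⟩
  filter_upwards [hl, hr, eventually_ge_atTop 1] with n hl hr hn u hu ht
  have hn0 : (0 : ℝ) < n := by exact_mod_cast hn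
  set t := leftInv (kernelEst k (b n) n x) u with htdef
  have hFt : kernelEst k (b n) n x t = u := kernelEst_leftInv hk (hb.pos n hn) hn x hu
  -- With both points equal the kernel factors become K(0) and 1 - K(0), while the estimator at t
  -- equals u exactly.
  have h1 := kernelEst_ge hk (hb.pos n hn) n x t t
  have h2 := one_sub_kernelEst_ge hk (hb.pos n hn) hn x t t
  rw [hFt, sub_self, zero_div, ← hK] at h1 h2
  obtain ⟨hc1, hc2⟩ := ceil_bounds hn hu
  have hc1' : (1 : ℝ) ≤ ⌈(n : ℝ) * u⌉₊ := by exact_mod_cast hc1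
  have hc2' : (⌈(n : ℝ) * u⌉₊ : ℝ) ≤ n := by exact_mod_cast hc2
  have hc3 := Nat.le_ceil ((n : ℝ) * u)
  have hc4 := Nat.ceil_lt_add_one (mul_nonneg hn0.le hu.1.le)
  have e1 := key hK0 hn0 h1 hc3 hc1'
  -- The added 1 in the right-hand rank makes it at least n(1-u), as ⌈nu⌉ < nu + 1.
  have e2 := key hK1 hn0 h2 (a := (n : ℝ) - ⌈(n : ℝ) * u⌉₊ + 1) (by linarith) (by linarith)
  have hKi : 0 < K⁻¹ := inv_pos.2 hK0
  have hKi' : 0 < (1 - K)⁻¹ := inv_pos.2 hK1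
  constructor
  · refine (hl t ht).trans ?_
    rw [mul_assoc]
    refine mul_le_mul_of_nonneg_left (e1.trans ?_) hC₀.le
    exact mul_le_mul_of_nonneg_right (by linarith) (by positivity)
  · refine (hr (1 - t) ⟨by linarith [ht.2], by linarith [ht.1]⟩).trans ?_
    rw [mul_assoc]
    refine mul_le_mul_of_nonneg_left (e2.trans ?_) hC₀.le
    have : 0 ≤ (n : ℝ) - ⌈(n : ℝ) * u⌉₊ + 1 := by linarith
    exact mul_le_mul_of_nonneg_right (by linarith) (by positivity)

/-- Control of the empirical quantile function at the boundary. -/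
theorem empQuantile_boundary (hC₀ : 0 < C₀)
    (hl : ∀ᶠ n : ℕ in atTop, ∀ t ∈ Ioo (0 : ℝ) 1,
      t ^ (1 + η) ≤ C₀ * (((countLT n x t : ℝ) + 1) / n))
    (hr : ∀ᶠ n : ℕ in atTop, ∀ t ∈ Ioo (0 : ℝ) 1,
      t ^ (1 + η) ≤ C₀ * (((countLT n (fun i => 1 - x i) t : ℝ) + 1) / n)) :
    ∀ᶠ n : ℕ in atTop, ∀ u ∈ Ioo (0 : ℝ) 1, empQuantile n x u ∈ Ioo (0 : ℝ) 1 →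
      empQuantile n x u ^ (1 + η) ≤ C₀ * (⌈(n : ℝ) * u⌉₊ / n) ∧
        (1 - empQuantile n x u) ^ (1 + η) ≤ C₀ * ((n - ⌈(n : ℝ) * u⌉₊ + 1) / n) := by
  filter_upwards [hl, hr, eventually_ge_atTop 1] with n hl hr hn u hu ht
  obtain ⟨h1, h2⟩ := countLT_empQuantile hn x hu
  set t := empQuantile n x u with htdef
  have h1' : (countLT n x t : ℝ) + 1 ≤ ⌈(n : ℝ) * u⌉₊ := by exact_mod_cast h1
  have h2' : (countLT n (fun i => 1 - x i) (1 - t) : ℝ) + ⌈(n : ℝ) * u⌉₊ ≤ n := by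
    rw [← Nat.cast_add]
    exact Nat.cast_le.2 h2
  constructor
  · refine (hl t ht).trans ?_
    gcongr
  · refine (hr (1 - t) ⟨by linarith [ht.2], by linarith [ht.1]⟩).trans ?_
    gcongr
    linarith

theorem measurable_empQuantile (n : ℕ) (x : ℕ → ℝ) : Measurable (empQuantile n x) :=
  measurable_natCeil_comp n fun i => if h : i - 1 < n then orderStat n x ⟨i - 1, h⟩ else 0

theorem integral_comp_empQuantile {n : ℕ} (hn : 1 ≤ n) (x : ℕ → ℝ) (f : ℝ → ℕ → ℝ) :
    ∫ u in Ioo (0 : ℝ) 1, f (empQuantile n x u) ⌈(n : ℝ) * u⌉₊ =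
      1 / (n : ℝ) * ∑ i : Fin n, f (orderStat n x i) (i + 1) := by
  have h := integral_natCeil hn fun i =>
    f (if h : i - 1 < n then orderStat n x ⟨i - 1, h⟩ else 0) i
  simp only [Finset.sum_range] at h
  refine h.trans ?_
  congr 1
  refine Finset.sum_congr rfl fun i _ => ?_
  simp

theorem sum_orderStat (n : ℕ) (x : ℕ → ℝ) (f : ℝ → ℝ) :
    ∑ i : Fin n, f (orderStat n x i) = ∑ i ∈ Finset.range n, f (x i) := by
  rw [Finset.sum_range]
  exact Equiv.sum_comp (Tuple.sort fun j : Fin n => x j) fun i : Fin n => f (x i)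

/-- The empirical quantile function takes each order statistic on a cell of length 1/n, and sorting
does not change the sum. -/
theorem lintegral_weight_empQuantile {n : ℕ} (hn : 1 ≤ n) (x : ℕ → ℝ) (s : ℝ) :
    ∫⁻ u in Ioo 0 1, ENNReal.ofReal (weight s (empQuantile n x u)) =
      ENNReal.ofReal ((∑ i ∈ Finset.range n, weight s (x i)) / n) := by
  rw [← ofReal_integral_eq_lintegral_ofReal, integral_comp_empQuantile hn x fun t _ => weight s t,
    sum_orderStat, one_div, div_eq_inv_mul]
  · exact integrableOn_natCeil n fun i =>
      weight s (if h : i - 1 < n then orderStat n x ⟨i - 1, h⟩ else 0)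
  · exact Eventually.of_forall fun u => weight_nonneg s _

theorem statOrder_eq_integral {g : ℝ → ℝ} {c : ℕ → ℕ → ℝ} {n : ℕ} (hn : 1 ≤ n)
    (hx : ∀ i, x i ∈ Ioo (0 : ℝ) 1) :
    statOrder g c n x =
      ∫ u in Ioo (0 : ℝ) 1, (Ioo (0 : ℝ) 1).indicator g (empQuantile n x u) * score c n u := by
  rw [setIntegral_congr_fun (g := fun u => (Ioo (0 : ℝ) 1).indicator g (empQuantile n x u) *
    c n ⌈(n : ℝ) * u⌉₊) measurableSet_Ioo fun u hu => by simp only [score_of_pos c hn hu],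
    integral_comp_empQuantile hn x fun t i => (Ioo (0 : ℝ) 1).indicator g t * c n i, statOrder]
  congr 1
  refine Finset.sum_congr rfl fun i _ => ?_
  rw [indicator_of_mem (show orderStat n x i ∈ Ioo (0 : ℝ) 1 from hx _)]

end Path

/-! ### Uniform samples -/

theorem map_eq_of_isUniform {Ω : Type*} [MeasurableSpace Ω] {P : Measure Ω} {X : Ω → ℝ}
    (h : pdf.IsUniform X (Ioo 0 1) P volume) : P.map X = volume.restrict (Ioo 0 1) := by
  rw [h, ProbabilityTheory.cond]
  simp

/-- Invariance under reflection transfers every estimate at 0 to the endpoint 1. -/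
theorem map_one_sub {Ω : Type*} [MeasurableSpace Ω] {P : Measure Ω} {X : Ω → ℝ}
    (hX : Measurable X) (h : P.map X = volume.restrict (Ioo 0 1)) :
    P.map (fun ω => 1 - X ω) = volume.restrict (Ioo 0 1) := by
  have hm : Measurable fun t : ℝ => 1 - t := by fun_prop
  have h1 : P.map (fun ω => 1 - X ω) = (P.map X).map fun t => 1 - t :=
    (Measure.map_map hm hX).symm
  have h2 := ((Measure.measurePreserving_sub_left volume (1 : ℝ)).restrict_preimage
    (measurableSet_Ioo (a := (0 : ℝ)) (b := 1))).map_eq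
  have h3 : (fun t : ℝ => 1 - t) ⁻¹' Ioo 0 1 = Ioo 0 1 := by
    ext t
    simp only [mem_preimage, mem_Ioo]
    constructor <;> rintro ⟨h, h'⟩ <;> constructor <;> linarith
  rw [h3] at h2
  rw [h1, h, h2]

theorem ae_mem_Ioo {Ω : Type*} [MeasurableSpace Ω] {P : Measure Ω} {X : Ω → ℝ}
    (hX : Measurable X) (h : P.map X = volume.restrict (Ioo 0 1)) :
    ∀ᵐ ω ∂P, X ω ∈ Ioo (0 : ℝ) 1 := by
  refine ae_of_ae_map hX.aemeasurable ?_
  rw [h]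
  exact ae_restrict_mem measurableSet_Ioo

end LStat

end

/-! ### Choice of exponents and assembly of the theorem -/

open LStat in
theorem theorem3
    {Ω : Type*} [MeasurableSpace Ω] (P : Measure Ω) [IsProbabilityMeasure P]
    (ξ : ℕ → Ω → ℝ) (hξ_meas : ∀ i, Measurable (ξ i)) (hξ_indep : iIndepFun ξ P)
    (hξ_unif : ∀ i, pdf.IsUniform (ξ i) (Ioo 0 1) P volume)
    (k : ℝ → ℝ) (hk : LStat.IsKernel k)
    (b : ℕ → ℝ) (hb : LStat.IsBandwidth b)
    (g : ℝ → ℝ) (hg : LStat.IsClassG g)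
    (c : ℕ → ℕ → ℝ)
    (J : Ioo (0 : ℝ) 1 → ℝ) (hJ : Measurable J)
    (M b₁ b₂ δ : ℝ) (hM : 0 < M) (hb₁ : 0 < b₁) (hb₂ : 0 < b₂) (hδ : 0 < δ)
    (hbound : LStat.IsBounded M b₁ b₂ δ g hg c J) :
    (∀ n, 1 ≤ n → IntegrableOn (fun t => g t * LStat.score c n t) (Ioo 0 1)) ∧
    (∀ᵐ ω ∂P, ∀ n, 1 ≤ n →
      IntegrableOn (LStat.integrandT g k c (b n) n (fun i => ξ i ω)) (Ioo 0 1)) ∧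
    (∀ᵐ ω ∂P, Tendsto
      (fun n => LStat.statT g k c (b n) n (fun i => ξ i ω) - LStat.centerMu g c n)
      atTop (𝓝 0)) ∧
    (∀ᵐ ω ∂P, Tendsto
      (fun n => LStat.statOrder g c n (fun i => ξ i ω) - LStat.centerMu g c n)
      atTop (𝓝 0)) := by
  -- Smoothing needs joint measurability of the scaled kernel. The estimator depends on the kernel
  -- only through K, so passing to a Borel version leaves it unchanged.
  obtain ⟨k', hk', hkm, hDF⟩ := hk.exists_measurable
  have hest : ∀ n, 1 ≤ n → ∀ x, kernelEst k (b n) n x = kernelEst k' (b n) n x := by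
    intro n hn x
    funext t
    rw [kernelEst_eq k (hb.pos n hn), kernelEst_eq k' (hb.pos n hn), hDF]
  have hmap := fun i => map_eq_of_isUniform (hξ_unif i)
  have hmeas' : ∀ i, Measurable fun ω => 1 - ξ i ω := fun i => measurable_const.sub (hξ_meas i)
  have hind' : iIndepFun (fun i ω => 1 - ξ i ω) P :=
    hξ_indep.comp (fun _ t => 1 - t) fun _ => measurable_const.sub measurable_id
  have hmap' := fun i => map_one_sub (hξ_meas i) (hmap i)
  -- exponents: `s` for the boundary weight, `p` for uniform integrability, `q` for concentration
  set η := δ / (2 * (b₁ + b₂)) with hη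
  have hη0 : 0 < η := by positivity
  set d := min (δ / 2) (1 / 2) with hd
  have hd0 : 0 < d := lt_min (by linarith) (by norm_num)
  have hd1 : d ≤ δ / 2 := min_le_left _ _
  have hd2 : d ≤ 1 / 2 := min_le_right _ _
  -- The loss b_i η at either end is at most δ/2, and d ≤ δ/2 makes s = 1 - d admissible.
  have hbη : b₁ * η + b₂ * η = δ / 2 := by
    rw [hη]
    field_simp
  have hs₁ : 1 - δ + b₁ * η ≤ 1 - d := by nlinarith [mul_pos hb₂ hη0]
  have hs₂ : 1 - δ + b₂ * η ≤ 1 - d := by nlinarith [mul_pos hb₁ hη0]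
  have hp : 1 < 1 + d := by linarith
  -- With p = 1 + d and q = 1 + d², the successive exponents are sp = 1 - d² and spq = 1 - d⁴, so
  -- the weight stays integrable after both powers.
  have hsp : (1 - d) * (1 + d) < 1 := by nlinarith
  have hq : 1 < 1 + d ^ 2 := by nlinarith
  have hsq : (1 - d) * (1 + d) * (1 + d ^ 2) < 1 := by
    have : 0 < d ^ 2 * d ^ 2 := by positivity
    nlinarith
  have hC₀ : (0 : ℝ) < 4 * 2 ^ (1 + η) := by positivity
  have hWq : Integrable fun t => weight ((1 - d) * (1 + d)) t ^ (1 + d ^ 2) := by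
    simp only [weight_rpow _ _ (by linarith : 1 + d ^ 2 ≠ 0)]
    exact integrable_weight hsq
  have hcl := ae_tendsto_countLT hξ_meas hξ_indep hmap
  have hcr := ae_tendsto_countLT hmeas' hind' hmap'
  have hbl := ae_eventually_rpow_le_countLT hξ_meas hξ_indep hmap hη0
  have hbr := ae_eventually_rpow_le_countLT hmeas' hind' hmap' hη0
  refine ⟨fun n hn => hbound.integrableOn_mul_score hM hδ hn, ?_, ?_, ?_⟩
  · refine Eventually.of_forall fun ω n hn => ?_
    obtain ⟨C, hC⟩ := exists_bound_score c n
    have h1 := integrableOn_comp_leftInv_kernelEst hk' hkm (hb.pos n hn) hn (fun i => ξ i ω)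
      hg.measurable_indicator (hbound.integrable_indicator hb₁ hb₂ hδ)
    rw [← hest n hn] at h1
    refine h1.mul_bdd (c := C) (measurable_score c n).aestronglyMeasurable ?_
    exact (ae_restrict_iff' measurableSet_Ioo).2 (Eventually.of_forall hC)
  · have hsmooth := ae_eventually_average_smoothing_le hξ_meas hξ_indep hmap hk' hkm hb
      (measurable_weight _) (integrable_weight hsp) (weight_nonneg _) hq hWq
    filter_upwards [hcl, hcr, hbl, hbr, hsmooth] with ω hcl hcr hbl hbr hsmooth
    obtain ⟨C, hC, hCb⟩ := leftInv_kernelEst_boundary hk' hb hC₀ hbl hbr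
    have h := hbound.tendsto_integral_sub_centerMu hM hb₁ hb₂ hδ hC hη0 hs₁ hs₂ hp hsp
      (G := fun n => leftInv (kernelEst k' (b n) n fun i => ξ i ω))
      (fun n hn => aemeasurable_leftInv_kernelEst hk' (hb.pos n hn) hn _)
      (fun u hu => tendsto_leftInv_kernelEst hk' hb hcl hcr hu) hCb
      (A := 4 * ((∫ t, weight ((1 - d) * (1 + d)) t) + 1)) ?_
    · refine h.congr' ?_
      filter_upwards [eventually_ge_atTop 1] with n hn
      simp only [statT, integrandT, hest n hn]
    · filter_upwards [hsmooth, eventually_ge_atTop 1] with n h1 hn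
      rw [lintegral_comp_leftInv_kernelEst hk' hkm (hb.pos n hn) hn _ (measurable_weight _)
        (integrable_weight hsp) (weight_nonneg _)]
      exact ENNReal.ofReal_le_ofReal h1
  · have hmem : ∀ᵐ ω ∂P, ∀ i, ξ i ω ∈ Ioo (0 : ℝ) 1 :=
      ae_all_iff.2 fun i => ae_mem_Ioo (hξ_meas i) (hmap i)
    have havg := ae_tendsto_average hξ_meas hξ_indep hmap (measurable_weight ((1 - d) * (1 + d)))
      (integrable_weight hsp).integrableOn
    filter_upwards [hcl, hcr, hbl, hbr, hmem, havg] with ω hcl hcr hbl hbr hmem havg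
    have h := hbound.tendsto_integral_sub_centerMu hM hb₁ hb₂ hδ hC₀ hη0 hs₁ hs₂ hp hsp
      (G := fun n => empQuantile n fun i => ξ i ω)
      (fun n _ => (measurable_empQuantile n _).aemeasurable)
      (fun u hu => tendsto_empQuantile hcl hcr hu) (empQuantile_boundary hC₀ hbl hbr)
      (A := (∫ t in Ioo 0 1, weight ((1 - d) * (1 + d)) t) + 1) ?_
    · refine h.congr' ?_
      filter_upwards [eventually_ge_atTop 1] with n hn
      rw [statOrder_eq_integral hn hmem]
    · filter_upwards [havg.eventually_lt_const (lt_add_one _), eventually_ge_atTop 1] with n h1 hn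
      rw [lintegral_weight_empQuantile hn]
      exact ENNReal.ofReal_le_ofReal h1.le
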